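/- For a partition $\lambda$ write $\lambda'$ for its conjugate, $|\lambda|$ for its size, and $\lambda=(\alpha_1,\dots,\alpha_r\,|\,\beta_1,\dots,\beta_r)$ for its Frobenius notation: $r$ is the number of diagonal cells of the Young diagram of $\lambda$, $\alpha_i=\lambda_i-i$ and $\beta_i=\lambda'_i-i$ for $1\le i\le r$. For $n\ge 0$ let $\mathcal P_n$ be the (finite) set of partitions of the form $(\alpha_1,\dots,\alpha_r\,|\,\alpha_1+1,\dots,\alpha_r+1)$, $r\ge 0$, with $\alpha_1+2\le n$ if $r\geq 1$; the empty partition ($r=0$) belongs to every $\mathcal P_n$. For nonnegative integers $p,q$, partitions $\lambda,\mu$ of length at most $p$ and $q$ respectively, and $\boldsymbol x=(x_1,\dots,x_{p+q})$, $\boldsymbol a=(a_1,\dots,a_{p+q})$, let $V^{p,q}_{\lambda,\mu}(\boldsymbol x;\boldsymbol a)$ be the $(p+q)\times(p+q)$ matrix with $i$th row $$\bigl(x_i^{\lambda_p},\,x_i^{\lambda_{p-1}+1},\,\dots,\,x_i^{\lambda_1+p-1},\ a_ix_i^{\mu_q},\,a_ix_i^{\mu_{q-1}+1},\,\dots,\,a_ix_i^{\mu_1+q-1}\bigr),$$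 and put $$F^{p,q}(\boldsymbol x;\boldsymbol a)=\sum_{\lambda\in\mathcal P_p,\ \mu\in\mathcal P_q}(-1)^{(|\lambda|+|\mu|)/2}\det V^{p,q}_{\lambda,\mu}(\boldsymbol x;\boldsymbol a)$$ (so $F^{0,0}=1$). The identities below are identities of rational functions; equivalently, they hold for elements of an arbitrary field for which the displayed denominators (in (b), those with $i<j$) do not vanish. (a) Let $n$ be a positive integer and $p,q$ nonnegative integers. For vectors $\boldsymbol x,\boldsymbol y,\boldsymbol a,\boldsymbol b$ of length $n$ and $\boldsymbol z,\boldsymbol c$ of length $p+q$, $$\det\left(\frac{F^{p+1,q+1}(x_i,y_j,\boldsymbol z;\,a_i,b_j,\boldsymbol c)}{(y_j-x_i)(1-x_iy_j)}\right)_{1\le i,j\le n}=\frac{(-1)^{n(n-1)/2}}{\prod_{i,j=1}^n(y_j-x_i)(1-x_iy_j)}\,F^{p,q}(\boldsymbol z;\boldsymbol c)^{n-1}\,F^{n+p,n+q}(\boldsymbol x,\boldsymbol y,\boldsymbol z;\,\boldsymbol a,\boldsymbol b,\boldsymbol c).$$ (b) Let $n$ be a positive integer and $p,q,r,s$ nonnegative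 integers. For vectors $\boldsymbol x,\boldsymbol a,\boldsymbol b$ of length $2n$, $\boldsymbol z,\boldsymbol c$ of length $p+q$, and $\boldsymbol w,\boldsymbol d$ of length $r+s$, $$\operatorname{Pf}\left(\frac{F^{p+1,q+1}(x_i,x_j,\boldsymbol z;\,a_i,a_j,\boldsymbol c)\,F^{r+1,s+1}(x_i,x_j,\boldsymbol w;\,b_i,b_j,\boldsymbol d)}{(x_j-x_i)(1-x_ix_j)}\right)_{1\le i,j\le 2n}$$ $$=\frac{1}{\prod_{1\le i<j\le 2n}(x_j-x_i)(1-x_ix_j)}\,F^{p,q}(\boldsymbol z;\boldsymbol c)^{n-1}\,F^{r,s}(\boldsymbol w;\boldsymbol d)^{n-1}\,F^{n+p,n+q}(\boldsymbol x,\boldsymbol z;\,\boldsymbol a,\boldsymbol c)\,F^{n+r,n+s}(\boldsymbol x,\boldsymbol w;\,\boldsymbol b,\boldsymbol d),$$ where the matrix is skew-symmetric, its diagonal entries being $0$, and $\operatorname{Pf}$ denotes the Pfaffian, $\operatorname{Pf}(m_{ij})=\sum_\sigma\operatorname{sgn}(\sigma)\prod_{i=1}^n m_{\sigma(2i-1),\sigma(2i)}$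 over permutations $\sigma$ of $\{1,\dots,2n\}$ with $\sigma(2i-1)<\sigma(2i)$ for all $i$ and $\sigma(1)<\sigma(3)<\dots<\sigma(2n-1)$. -/

import Mathlib

namespace CauchyVariation

/-- The number of cells on the main diagonal of a Young diagram. -/
def diagLen (μ : YoungDiagram) : ℕ := (μ.cells.filter fun c => c.1 = c.2).card

/-- `μ = (α₁, …, α_r | β₁, …, β_r)` in Frobenius notation: `r` is the number of diagonal cells,
`α_i = μ_i - i` and `β_i = μ'_i - i` for `1 ≤ i ≤ r`
(here rows, columns and the index `i` are numbered from `0`). -/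
def HasFrobenius (μ : YoungDiagram) {r : ℕ} (α β : Fin r → ℕ) : Prop :=
  diagLen μ = r ∧
    ∀ i : Fin r, μ.rowLen i = α i + (i + 1) ∧ μ.colLen i = β i + (i + 1)

/-- The set of partitions `(α₁, …, α_r | α₁ + 1, …, α_r + 1)`, `r ≥ 0`, with `α₁ + 2 ≤ n`
(no condition when `r = 0`, so the empty partition always belongs to it). -/
def partitionSet (n : ℕ) : Set YoungDiagram :=
  {μ | ∃ (r : ℕ) (α : Fin r → ℕ), StrictAnti α ∧ HasFrobenius μ α (fun i => α i + 1) ∧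
    ∀ i, α i + 2 ≤ n}

theorem partitionSet_finite (n : ℕ) : (partitionSet n).Finite := by
  have hfin : {μ : YoungDiagram | μ.cells ⊆ Finset.range n ×ˢ Finset.range n}.Finite := by
    refine Set.Finite.of_finite_image (f := YoungDiagram.cells)
      ((Finset.finite_toSet (Finset.range n ×ˢ Finset.range n).powerset).subset ?_)
      (fun μ _ ν _ h => YoungDiagram.ext h)
    rintro _ ⟨μ, hμ, rfl⟩
    exact Finset.mem_coe.mpr (Finset.mem_powerset.mpr hμ)
  refine hfin.subset ?_
  rintro μ ⟨r, α, -, ⟨hr, hF⟩, hα⟩ ⟨i, j⟩ hc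
  have hc' : (i, j) ∈ μ := hc
  have h0 : (0, 0) ∈ μ := μ.up_left_mem (Nat.zero_le i) (Nat.zero_le j) hc'
  have hrpos : 0 < r := by
    rw [← hr]
    exact Finset.card_pos.mpr ⟨(0, 0), Finset.mem_filter.mpr ⟨h0, rfl⟩⟩
  have hF0 := hF ⟨0, hrpos⟩
  have hα0 := hα ⟨0, hrpos⟩
  have hj : j < μ.rowLen 0 :=
    YoungDiagram.mem_iff_lt_rowLen.mp (μ.up_left_mem (Nat.zero_le i) le_rfl hc')
  have hi : i < μ.colLen 0 :=
    YoungDiagram.mem_iff_lt_colLen.mp (μ.up_left_mem le_rfl (Nat.zero_le j) hc')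
  simp only [Finset.mem_product, Finset.mem_range]
  simp only at hF0
  omega

/-- `partitionSet n` as a finite set. -/
noncomputable def P (n : ℕ) : Finset YoungDiagram := (partitionSet_finite n).toFinset

/-- The matrix `V^{p,q}_{lam,mu}(x; a)`, whose `i`-th row is
`(x_i^{lam_p}, x_i^{lam_{p-1}+1}, …, x_i^{lam_1+p-1},
  a_i x_i^{mu_q}, a_i x_i^{mu_{q-1}+1}, …, a_i x_i^{mu_1+q-1})`.
Rows of a diagram are numbered from `0`, so `k.rev = p - 1 - k` is the row of `lam_{p-k}`. -/
def V {R : Type*} [CommRing R] (p q : ℕ) (lam mu : YoungDiagram) (x a : Fin (p + q) → R) :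
    Matrix (Fin (p + q)) (Fin (p + q)) R :=
  Matrix.of fun i => Fin.append
    (fun k : Fin p => x i ^ (lam.rowLen k.rev + k))
    (fun k : Fin q => a i * x i ^ (mu.rowLen k.rev + k))

/-- `F^{p,q}(x; a)`. The size of every member of `P n` is even, so the exponent is exact. -/
noncomputable def F {R : Type*} [CommRing R] (p q : ℕ) (x a : Fin (p + q) → R) : R :=
  ∑ lam ∈ P p, ∑ mu ∈ P q, (-1) ^ ((lam.card + mu.card) / 2) * (V p q lam mu x a).det

/-- The permutations `σ` of `{0, …, 2n-1}` with `σ(2i) < σ(2i+1)` for all `i` and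
`σ(0) < σ(2) < σ(4) < ⋯`, one for each perfect matching. -/
def matchingPerms (n : ℕ) : Finset (Equiv.Perm (Fin (2 * n))) :=
  Finset.univ.filter fun σ =>
    (∀ i : Fin n, σ ⟨2 * i, by omega⟩ < σ ⟨2 * i + 1, by omega⟩) ∧
    (∀ i j : Fin n, i < j → σ ⟨2 * i, by omega⟩ < σ ⟨2 * j, by omega⟩)

/-- The Pfaffian of a `2n × 2n` skew-symmetric matrix (only the entries above the diagonal
enter). -/
def pfaffian {R : Type*} [CommRing R] {n : ℕ} (A : Matrix (Fin (2 * n)) (Fin (2 * n)) R) : R :=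
  ∑ σ ∈ matchingPerms n, ((Equiv.Perm.sign σ : ℤ) : R) *
    ∏ i : Fin n, A (σ ⟨2 * i, by omega⟩) (σ ⟨2 * i + 1, by omega⟩)

end CauchyVariation

open CauchyVariation

namespace CauchyVariation

/-! `F` is a single determinant in disguise. Passing from `P p` to `P (p + 1)` either keeps a
partition or adds a maximal hook around it. In terms of the exponents `λ_{p-k} + k` this recursion,
with its signs, is the multilinear expansion of a determinant with columns `x^k + x^(2p-2-k)`
(`sum_P_alternatingMap`). Such a palindromic entry is `x^k (1+x^2)^(p-1-k)` plus terms of the same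
shape with larger `k`, so triangular column operations turn the columns into binary monomials at the
point `(x, 1+x^2)` (`F_eq_det_hmat`). The denominators are the 2×2 determinants of these points:
`(y-x)(1-xy) = y(1+x^2) - x(1+y^2)`.

The parameters `z, c` can then be eliminated. If `F p q z c` and all `z k` are nonzero, column
operations clear the rows of `z` in the first `n` columns of each family. What remains is the case
`p = q = 0` with `(1, a)` replaced by `(φ₁ x a, φ₂ x a)`, where `φ₁, φ₂` do not depend on `n`
(`exists_F_append_eq`). Comparing `n = 1` with general `n` yields the power `F p q z c ^ (n - 1)`
(`exists_F_eq_core`).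

Two homogeneous identities are left. The Cauchy determinant follows by passing to the Lagrange basis
at half of the points (`det_cauchy_core`). The Schur Pfaffian follows by induction: the product of
the two determinants is a form in the first point, and its Lagrange interpolation at the other
points is the expansion of the Pfaffian along its first row (`pfaffian_schur_core`).

The nonvanishing conditions hold when the parameters concerned are independent variables, and
evaluation gives the general case. -/

/-! ### The sets `P n` and their hook recursion -/

theorem diag_mem_iff_lt_diagLen (μ : YoungDiagram) (i : ℕ) : (i, i) ∈ μ ↔ i < diagLen μ := by
  classical
  have hex : ∃ m, (m, m) ∉ μ := ⟨μ.rowLen 0, fun h =>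
    (lt_irrefl _) (YoungDiagram.mem_iff_lt_rowLen.mp (μ.up_left_mem (Nat.zero_le _) le_rfl h))⟩
  have hm : ∀ i, (i, i) ∈ μ ↔ i < Nat.find hex := fun i =>
    ⟨fun h => by
      by_contra hlt
      exact Nat.find_spec hex (μ.up_left_mem (not_lt.mp hlt) (not_lt.mp hlt) h),
     fun h => not_not.mp (Nat.find_min hex h)⟩
  have hcells : (μ.cells.filter fun c => c.1 = c.2) =
      (Finset.range (Nat.find hex)).image fun i => (i, i) := by
    ext ⟨a, b⟩
    simp only [Finset.mem_filter, YoungDiagram.mem_cells, Finset.mem_image, Finset.mem_range,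
      Prod.mk.injEq]
    constructor
    · rintro ⟨h, rfl⟩
      exact ⟨a, (hm a).mp h, rfl, rfl⟩
    · rintro ⟨c, hc, rfl, rfl⟩
      exact ⟨(hm c).mpr hc, rfl⟩
  rw [hm, diagLen, hcells, Finset.card_image_of_injective _ fun a b h => (Prod.mk.inj h).1,
    Finset.card_range]

/-- The Frobenius data are determined by the rows and columns through the diagonal, so only a
condition at each diagonal cell remains. Strict decrease of the arms is automatic, since row lengths
decrease weakly. -/
theorem mem_partitionSet_iff {n : ℕ} {μ : YoungDiagram} : μ ∈ partitionSet n ↔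
    ∀ i, (i, i) ∈ μ → μ.colLen i = μ.rowLen i + 1 ∧ μ.rowLen i + 1 ≤ n + i := by
  constructor
  · rintro ⟨r, α, -, ⟨hr, hF⟩, hα⟩ i hi
    rw [diag_mem_iff_lt_diagLen, hr] at hi
    have h1 := hF ⟨i, hi⟩
    have h2 := hα ⟨i, hi⟩
    simp only at h1
    omega
  · intro h
    have hd : ∀ i : Fin (diagLen μ), (i : ℕ) < μ.rowLen i := fun i =>
      YoungDiagram.mem_iff_lt_rowLen.mp ((diag_mem_iff_lt_diagLen μ i).mpr i.2)
    refine ⟨diagLen μ, fun i => μ.rowLen i - (i + 1), fun i j hij => ?_, ⟨rfl, fun i => ?_⟩,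
      fun i => ?_⟩
    · have h1 := hd i
      have h2 := hd j
      have h3 := μ.rowLen_anti i j (le_of_lt hij)
      have h4 : (i : ℕ) < j := hij
      simp only
      omega
    all_goals
      have h1 := hd i
      have h2 := h i ((diag_mem_iff_lt_diagLen μ i).mpr i.2)
      simp only
      omega

theorem rowLen_eq_of_forall_mem_iff {μ : YoungDiagram} {i m : ℕ} (h : ∀ j, (i, j) ∈ μ ↔ j < m) :
    μ.rowLen i = m :=
  eq_of_forall_lt_iff fun j => by rw [← YoungDiagram.mem_iff_lt_rowLen, h]

theorem colLen_eq_of_forall_mem_iff {μ : YoungDiagram} {j m : ℕ} (h : ∀ i, (i, j) ∈ μ ↔ i < m) :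
    μ.colLen j = m :=
  eq_of_forall_lt_iff fun i => by rw [← YoungDiagram.mem_iff_lt_colLen, h]

theorem mem_P {n : ℕ} {μ : YoungDiagram} : μ ∈ P n ↔
    ∀ i, (i, i) ∈ μ → μ.colLen i = μ.rowLen i + 1 ∧ μ.rowLen i + 1 ≤ n + i := by
  rw [P, Set.Finite.mem_toFinset, mem_partitionSet_iff]

theorem bounds_of_mem_P {n : ℕ} {μ : YoungDiagram} (h : μ ∈ P n) {i j : ℕ} (hc : (i, j) ∈ μ) :
    i < n ∧ j + 1 < n := by
  have h0 := mem_P.mp h 0 (μ.up_left_mem (Nat.zero_le i) (Nat.zero_le j) hc)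
  have h1 := YoungDiagram.mem_iff_lt_rowLen.mp (μ.up_left_mem (Nat.zero_le i) le_rfl hc)
  have h2 := YoungDiagram.mem_iff_lt_colLen.mp (μ.up_left_mem le_rfl (Nat.zero_le j) hc)
  omega

/-- The diagram obtained from `ν` by adding a first row of length `p` and a first column of
length `p + 1`, truncated to the rectangle that these span. -/
def addHook (p : ℕ) (ν : YoungDiagram) : YoungDiagram where
  cells := (Finset.range (p + 1) ×ˢ Finset.range p).filter
    fun c => c.1 = 0 ∨ c.2 = 0 ∨ (c.1 - 1, c.2 - 1) ∈ ν
  isLowerSet := by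
    rintro ⟨a, b⟩ ⟨c, d⟩ ⟨hca, hdb⟩ h
    simp only [Finset.coe_filter, Finset.mem_product, Finset.mem_range, Set.mem_ofPred_eq] at h ⊢
    simp only at hca hdb
    refine ⟨⟨by omega, by omega⟩, ?_⟩
    rcases h.2 with h0 | h0 | h0
    · left; omega
    · right; left; omega
    · right; right
      exact ν.up_left_mem (by omega) (by omega) h0

theorem mem_addHook {p : ℕ} {ν : YoungDiagram} {i j : ℕ} : (i, j) ∈ addHook p ν ↔
    i < p + 1 ∧ j < p ∧ (i = 0 ∨ j = 0 ∨ (i - 1, j - 1) ∈ ν) := by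
  rw [← YoungDiagram.mem_cells, addHook]
  simp [and_assoc]

/-- The diagram obtained by deleting the first row and the first column. -/
def removeHook (μ : YoungDiagram) : YoungDiagram where
  cells := μ.cells.filter fun c => (c.1 + 1, c.2 + 1) ∈ μ
  isLowerSet := by
    rintro ⟨a, b⟩ ⟨c, d⟩ ⟨hca, hdb⟩ h
    simp only [Finset.coe_filter, YoungDiagram.mem_cells, Set.mem_ofPred_eq] at h ⊢
    simp only at hca hdb
    exact ⟨μ.up_left_mem hca hdb h.1, μ.up_left_mem (by omega) (by omega) h.2⟩

theorem mem_removeHook {μ : YoungDiagram} {i j : ℕ} :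
    (i, j) ∈ removeHook μ ↔ (i + 1, j + 1) ∈ μ := by
  rw [← YoungDiagram.mem_cells, removeHook]
  simp only [Finset.mem_filter, YoungDiagram.mem_cells, and_iff_right_iff_imp]
  exact μ.up_left_mem (Nat.le_succ _) (Nat.le_succ _)

theorem removeHook_addHook {p : ℕ} {ν : YoungDiagram} (h : ν ∈ P p) :
    removeHook (addHook p ν) = ν := by
  ext ⟨i, j⟩
  rw [YoungDiagram.mem_cells, YoungDiagram.mem_cells, mem_removeHook, mem_addHook]
  simp only [Nat.add_eq_zero_iff, one_ne_zero, and_false, false_or, Nat.add_sub_cancel]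
  exact ⟨fun h => h.2.2, fun hc => by have := bounds_of_mem_P h hc; exact ⟨by omega, by omega, hc⟩⟩

theorem rowLen_addHook_zero (p : ℕ) (ν : YoungDiagram) : (addHook p ν).rowLen 0 = p :=
  rowLen_eq_of_forall_mem_iff fun j => by simp [mem_addHook]

theorem colLen_addHook_zero {p : ℕ} (hp : 0 < p) (ν : YoungDiagram) :
    (addHook p ν).colLen 0 = p + 1 :=
  colLen_eq_of_forall_mem_iff fun i => by simp [mem_addHook, hp]

theorem rowLen_addHook_succ {p : ℕ} {ν : YoungDiagram} (h : ν ∈ P p) {i : ℕ} (hi : i < p) :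
    (addHook p ν).rowLen (i + 1) = ν.rowLen i + 1 := by
  refine rowLen_eq_of_forall_mem_iff fun j => ?_
  rw [mem_addHook]
  rcases j with _ | j
  · simp only [true_or, or_true, and_true]; omega
  · have hb := @bounds_of_mem_P p ν h i j
    simp only [Nat.add_eq_zero_iff, one_ne_zero, and_false, false_or, Nat.add_sub_cancel,
      YoungDiagram.mem_iff_lt_rowLen] at hb ⊢
    omega

theorem colLen_addHook_succ {p : ℕ} {ν : YoungDiagram} (h : ν ∈ P p) {j : ℕ} (hj : j + 1 < p) :
    (addHook p ν).colLen (j + 1) = ν.colLen j + 1 := by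
  refine colLen_eq_of_forall_mem_iff fun i => ?_
  rw [mem_addHook]
  rcases i with _ | i
  · simp only [true_or, and_true]; omega
  · have hb := @bounds_of_mem_P p ν h i j
    simp only [Nat.add_eq_zero_iff, one_ne_zero, and_false, false_or, Nat.add_sub_cancel,
      YoungDiagram.mem_iff_lt_colLen] at hb ⊢
    omega

theorem rowLen_removeHook (μ : YoungDiagram) (i : ℕ) :
    (removeHook μ).rowLen i = μ.rowLen (i + 1) - 1 := by
  refine rowLen_eq_of_forall_mem_iff fun j => ?_
  rw [mem_removeHook, YoungDiagram.mem_iff_lt_rowLen]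
  omega

theorem colLen_removeHook (μ : YoungDiagram) (j : ℕ) :
    (removeHook μ).colLen j = μ.colLen (j + 1) - 1 := by
  refine colLen_eq_of_forall_mem_iff fun i => ?_
  rw [mem_removeHook, YoungDiagram.mem_iff_lt_colLen]
  omega

theorem addHook_mem_P {p : ℕ} (hp : 0 < p) {ν : YoungDiagram} (h : ν ∈ P p) :
    addHook p ν ∈ P (p + 1) := by
  refine mem_P.mpr fun i hi => ?_
  rcases i with _ | i
  · rw [rowLen_addHook_zero, colLen_addHook_zero hp]; omega
  · rw [mem_addHook] at hi
    simp only [Nat.add_eq_zero_iff, one_ne_zero, and_false, false_or, Nat.add_sub_cancel] at hi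
    have h1 := mem_P.mp h i hi.2.2
    rw [rowLen_addHook_succ h (by omega), colLen_addHook_succ h (by omega)]
    omega

theorem removeHook_mem_P {p : ℕ} {μ : YoungDiagram} (h : μ ∈ P (p + 1)) :
    removeHook μ ∈ P p := by
  refine mem_P.mpr fun i hi => ?_
  rw [mem_removeHook] at hi
  have h1 := mem_P.mp h _ hi
  have h0 := mem_P.mp h 0 (μ.up_left_mem (Nat.zero_le _) (Nat.zero_le _) hi)
  have h2 := μ.rowLen_anti 0 (i + 1) (Nat.zero_le _)
  have h3 := YoungDiagram.mem_iff_lt_rowLen.mp hi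
  rw [rowLen_removeHook, colLen_removeHook]
  omega

theorem addHook_removeHook {p : ℕ} {μ : YoungDiagram} (h : μ ∈ P (p + 1)) (hn : μ ∉ P p) :
    addHook p (removeHook μ) = μ := by
  have key : μ.rowLen 0 = p ∧ μ.colLen 0 = p + 1 := by
    rw [mem_P] at hn
    push Not at hn
    obtain ⟨i, hi, hi'⟩ := hn
    have h1 := mem_P.mp h i hi
    have h0 := mem_P.mp h 0 (μ.up_left_mem (Nat.zero_le _) (Nat.zero_le _) hi)
    have h2 := μ.rowLen_anti 0 i (Nat.zero_le _)
    -- A violated bound means `p + i ≤ μ.rowLen i`, while `μ.rowLen i ≤ μ.rowLen 0 ≤ p`. Hence `i =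
    -- 0` and the first row has length exactly `p`.
    have h3 := hi' h1.1
    omega
  ext ⟨i, j⟩
  rw [YoungDiagram.mem_cells, YoungDiagram.mem_cells, mem_addHook]
  rcases i with _ | i
  · rw [YoungDiagram.mem_iff_lt_rowLen (μ := μ), key.1]; simp
  rcases j with _ | j
  · rw [YoungDiagram.mem_iff_lt_colLen (μ := μ), key.2]
    simp only [true_or, or_true, and_true]
    -- Cells of the first column of `addHook p _` require `0 < p`, which the corner cell supplies.
    have h00 : (0, 0) ∈ μ := by rw [YoungDiagram.mem_iff_lt_colLen, key.2]; omega
    rw [YoungDiagram.mem_iff_lt_rowLen, key.1] at h00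
    omega
  · simp only [Nat.add_eq_zero_iff, one_ne_zero, and_false, false_or, Nat.add_sub_cancel,
      mem_removeHook]
    refine ⟨fun h => h.2.2, fun hc => ?_⟩
    have := bounds_of_mem_P h hc
    exact ⟨by omega, by omega, hc⟩

theorem card_addHook {p : ℕ} {ν : YoungDiagram} (h : ν ∈ P p) :
    (addHook p ν).card = ν.card + 2 * p := by
  classical
  have hcells : (addHook p ν).cells =
      ((Finset.range p).image (fun j => ((0 : ℕ), j)) ∪
        (Finset.range p).image (fun i => (i + 1, (0 : ℕ)))) ∪
        ν.cells.image (fun c => (c.1 + 1, c.2 + 1)) := by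
    ext ⟨i, j⟩
    rw [YoungDiagram.mem_cells, mem_addHook]
    have hb := @bounds_of_mem_P p ν h (i - 1) (j - 1)
    rcases i with _ | i
    · simp
    rcases j with _ | j
    · simp only [Finset.mem_union, Finset.mem_image, Finset.mem_range, Prod.mk.injEq]
      constructor
      · rintro ⟨h1, -, -⟩
        exact Or.inl (Or.inr ⟨i, by omega, rfl, trivial⟩)
      · rintro ((⟨_, _, h0, _⟩ | ⟨k, hk, h0, _⟩) | ⟨_, _, _, h0⟩)
        · exact absurd h0 (by omega)
        · exact ⟨by omega, by omega, Or.inr (Or.inl trivial)⟩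
        · exact absurd h0 (by omega)
    · simp only [Nat.add_sub_cancel] at hb
      simp only [Finset.mem_union, Finset.mem_image, Finset.mem_range, Prod.mk.injEq,
        YoungDiagram.mem_cells, Prod.exists, Nat.add_sub_cancel]
      constructor
      · rintro ⟨-, -, h0 | h0 | h0⟩
        · exact absurd h0 (by omega)
        · exact absurd h0 (by omega)
        · exact Or.inr ⟨i, j, h0, rfl, rfl⟩
      · rintro ((⟨_, _, h0, _⟩ | ⟨_, _, _, h0⟩) | ⟨a, b, hc, h1, h2⟩)
        · exact absurd h0 (by omega)
        · exact absurd h0 (by omega)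
        · obtain rfl : a = i := by omega
          obtain rfl : b = j := by omega
          have := hb hc
          exact ⟨by omega, by omega, Or.inr (Or.inr hc)⟩
  have h1 : ((Finset.range p).image (fun j => ((0 : ℕ), j))).card = p := by
    rw [Finset.card_image_of_injective _ (fun a b h => (Prod.mk.inj h).2), Finset.card_range]
  have h2 : ((Finset.range p).image (fun i => (i + 1, (0 : ℕ)))).card = p := by
    rw [Finset.card_image_of_injective _ (fun a b h => by simpa using h), Finset.card_range]
  have h3 : (ν.cells.image (fun c => (c.1 + 1, c.2 + 1))).card = ν.cells.card :=
    Finset.card_image_of_injective _ (fun a b h => by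
      simp only [Prod.mk.injEq, Nat.add_right_cancel_iff] at h
      exact Prod.ext h.1 h.2)
  rw [YoungDiagram.card, hcells, Finset.card_union_of_disjoint, Finset.card_union_of_disjoint,
    h1, h2, h3, YoungDiagram.card]
  · ring
  · simp only [Finset.disjoint_left, Finset.mem_image, not_exists, not_and]
    rintro _ ⟨a, -, rfl⟩ b - h
    simp at h
  · simp only [Finset.disjoint_left, Finset.mem_union, Finset.mem_image, not_exists, not_and]
    rintro _ (⟨a, -, rfl⟩ | ⟨a, -, rfl⟩) b - h <;> simp at h

-- The arm length allowed by `P (p + 1)` but not by `P p` can occur only in the first hook, and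
-- deleting that hook leaves a member of `P p`. For `p = 0` the added hook would be empty, and `P 0
-- = P 1 = {⊥}`.
open scoped Classical in
theorem P_succ {p : ℕ} (hp : 0 < p) : P (p + 1) = P p ∪ (P p).image (addHook p) := by
  ext μ
  rw [Finset.mem_union, Finset.mem_image]
  constructor
  · intro h
    by_cases hn : μ ∈ P p
    · exact Or.inl hn
    · exact Or.inr ⟨_, removeHook_mem_P h, addHook_removeHook h hn⟩
  · rintro (h | ⟨ν, h, rfl⟩)
    · exact mem_P.mpr fun i hi => by have := mem_P.mp h i hi; omega
    · exact addHook_mem_P hp h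

theorem sum_P_succ {R : Type*} [AddCommMonoid R] {p : ℕ} (hp : 0 < p) (t : YoungDiagram → R) :
    ∑ μ ∈ P (p + 1), t μ = ∑ μ ∈ P p, t μ + ∑ μ ∈ P p, t (addHook p μ) := by
  classical
  rw [P_succ hp, Finset.sum_union, Finset.sum_image]
  · intro μ hμ ν hν h
    rw [← removeHook_addHook hμ, ← removeHook_addHook hν, h]
  · rw [Finset.disjoint_left]
    intro μ hμ h
    obtain ⟨ν, -, rfl⟩ := Finset.mem_image.mp h
    have h0 := mem_P.mp hμ 0 (mem_addHook.mpr ⟨by omega, by omega, Or.inl rfl⟩)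
    rw [rowLen_addHook_zero] at h0
    omega

theorem P_eq_singleton_of_le_one {p : ℕ} (hp : p ≤ 1) : P p = {⊥} := by
  ext μ
  rw [Finset.mem_singleton]
  constructor
  · intro h
    ext ⟨i, j⟩
    rw [YoungDiagram.mem_cells, YoungDiagram.mem_cells]
    refine ⟨fun hc => ?_, fun hc => absurd hc (YoungDiagram.notMem_bot _)⟩
    have := bounds_of_mem_P h hc
    omega
  · rintro rfl
    exact mem_P.mpr fun i hi => absurd hi (YoungDiagram.notMem_bot _)

theorem card_bot : (⊥ : YoungDiagram).card = 0 := by simp [YoungDiagram.card]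

/-- Every added hook has `2 * p` cells. Evenness lets the exponent `(|λ| + |μ|) / 2` split, so that
the double sum in `F` separates. -/
theorem even_card_of_mem_P : ∀ {p : ℕ} {μ : YoungDiagram}, μ ∈ P p → Even μ.card := by
  classical
  intro p
  induction p with
  | zero =>
    intro μ h
    rw [P_eq_singleton_of_le_one zero_le_one, Finset.mem_singleton] at h
    simp [h, card_bot]
  | succ p ih =>
    intro μ h
    rcases Nat.eq_zero_or_pos p with rfl | hp
    · rw [P_eq_singleton_of_le_one le_rfl, Finset.mem_singleton] at h
      simp [h, card_bot]
    · rw [P_succ hp, Finset.mem_union, Finset.mem_image] at h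
      rcases h with h | ⟨ν, h, rfl⟩
      · exact ih h
      · rw [card_addHook h]
        exact (ih h).add (even_two_mul p)

theorem rowLen_bot (i : ℕ) : (⊥ : YoungDiagram).rowLen i = 0 :=
  rowLen_eq_of_forall_mem_iff fun j => by simp [YoungDiagram.notMem_bot]

/-! ### Signed sums over `P p` as one value of an alternating map -/

theorem AlternatingMap.map_snoc {R M N : Type*} [CommRing R] [AddCommGroup M] [Module R M]
    [AddCommGroup N] [Module R N] {p : ℕ} (Φ : M [⋀^Fin (p + 1)]→ₗ[R] N) (v : Fin p → M) (m : M) :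
    Φ (Fin.snoc v m) = (-1 : ℤˣ) ^ p • Φ (Fin.cons m v) := by
  have h : (Fin.snoc v m : Fin (p + 1) → M) = (Fin.cons m v : Fin (p + 1) → M) ∘ finRotate (p + 1) := by
    rw [Fin.snoc_eq_cons_rotate]
    rfl
  rw [h, AlternatingMap.map_perm, sign_finRotate, Nat.add_sub_cancel]

/-- The signed sum over `P p` of the values of an alternating map at the vectors whose exponents
are the beta-numbers of the partitions factors. -/
theorem sum_P_alternatingMap {R M N : Type*} [CommRing R] [AddCommGroup M] [Module R M]
    [AddCommGroup N] [Module R N] (p : ℕ) : ∀ (Φ : M [⋀^Fin p]→ₗ[R] N) (e : ℕ → M),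
    ∑ μ ∈ P p, (-1 : R) ^ (μ.card / 2) • Φ (fun k => e (μ.rowLen k.rev + k)) =
      Φ fun k => if (k : ℕ) + 1 = p then e k else e k + e (2 * p - 2 - k) := by
  induction p with
  | zero =>
    intro Φ e
    simp only [P_eq_singleton_of_le_one zero_le_one, Finset.sum_singleton, card_bot,
      Nat.zero_div, pow_zero, one_smul]
    exact congrArg Φ (Subsingleton.elim _ _)
  | succ p ih =>
    intro Φ e
    -- The hook recursion starts at `p = 1`, so `P 1 = {⊥}` is treated separately.
    rcases Nat.eq_zero_or_pos p with rfl | hp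
    · simp only [P_eq_singleton_of_le_one le_rfl, Finset.sum_singleton, card_bot,
        Nat.zero_div, pow_zero, one_smul, rowLen_bot]
      refine congrArg Φ (funext fun k => ?_)
      simp
    -- The two parts of the recursion put `e 0` or `e (2 * p)` in front of the same `p` vectors, so
    -- together they are one map curried at the sum. The exponents of those vectors are larger by
    -- one, hence the shifted family.
    have ih' := ih (Φ.curryLeft (e 0 + e (2 * p))) fun k => e (k + 1)
    simp only [map_add, AlternatingMap.add_apply, smul_add, Finset.sum_add_distrib] at ih'
    rw [sum_P_succ hp]
    have hA : ∑ μ ∈ P p, (-1 : R) ^ (μ.card / 2) •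
          Φ (fun k : Fin (p + 1) => e (μ.rowLen k.rev + k)) =
        ∑ μ ∈ P p, (-1 : R) ^ (μ.card / 2) •
          Φ.curryLeft (e 0) fun k : Fin p => e (μ.rowLen k.rev + k + 1) := by
      refine Finset.sum_congr rfl fun μ hμ => ?_
      congr 1
      rw [AlternatingMap.curryLeft_apply_apply]
      congr 1
      ext k
      refine Fin.cases ?_ (fun k => ?_) k
      · have : μ.rowLen p = 0 := by
          by_contra h
          rw [← Ne, ← Nat.pos_iff_ne_zero, ← YoungDiagram.mem_iff_lt_rowLen] at h
          have := bounds_of_mem_P hμ h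
          omega
        simp [Matrix.vecCons, this]
      · simp [Matrix.vecCons, Fin.rev_succ, add_assoc]
    -- The hook contributes the exponent `p + p` in the last place and leaves the other exponents as
    -- in `hA`.
    have hB : ∑ μ ∈ P p, (-1 : R) ^ ((addHook p μ).card / 2) •
          Φ (fun k : Fin (p + 1) => e ((addHook p μ).rowLen k.rev + k)) =
        ∑ μ ∈ P p, (-1 : R) ^ (μ.card / 2) •
          Φ.curryLeft (e (2 * p)) fun k : Fin p => e (μ.rowLen k.rev + k + 1) := by
      refine Finset.sum_congr rfl fun μ hμ => ?_
      have hv : (fun k : Fin (p + 1) => e ((addHook p μ).rowLen k.rev + k)) =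
          Fin.snoc (fun k : Fin p => e (μ.rowLen k.rev + k + 1)) (e (2 * p)) := by
        ext k
        refine Fin.lastCases ?_ (fun k => ?_) k
        · simp [rowLen_addHook_zero, two_mul]
        · simp only [Fin.snoc_castSucc, Fin.rev_castSucc, Fin.val_succ, Fin.val_castSucc]
          rw [rowLen_addHook_succ hμ k.rev.2]
          congr 1
          omega
      -- Moving the last vector to the front costs `(-1) ^ p`, which cancels the sign coming from
      -- the `2 * p` added cells.
      rw [hv, AlternatingMap.map_snoc, card_addHook hμ, AlternatingMap.curryLeft_apply_apply]
      have h2 : (μ.card + 2 * p) / 2 = μ.card / 2 + p := by omega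
      have h3 : ∀ w : N, ((-1 : ℤˣ) ^ p • w) = (-1 : R) ^ p • w := by
        intro w
        rcases Nat.even_or_odd p with h | h <;> simp [h.neg_one_pow]
      rw [h2, h3, smul_smul, pow_add, mul_assoc, ← mul_pow]
      simp [Matrix.vecCons]
    rw [hA, hB, ih', ← AlternatingMap.add_apply, ← map_add, AlternatingMap.curryLeft_apply_apply]
    congr 1
    ext k
    refine Fin.cases ?_ (fun k => ?_) k
    · simp [Matrix.vecCons, hp.ne', mul_add]
    · simp only [Matrix.vecCons, Fin.cons_succ, Fin.val_succ, Nat.add_right_cancel_iff]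
      split_ifs
      · rfl
      · congr 2
        omega

/-! ### Reduction of `F` to a determinant of binary monomials -/

/-- Triangular column operations multiply a determinant by the diagonal of the transformation. -/
theorem det_eq_of_triangular_columns {ι R : Type*} [Fintype ι] [DecidableEq ι] [CommRing R]
    (M M' : Matrix ι ι R) (u : ι → R) (b : ι → ℕ)
    (h : ∀ j, M'.col j - u j • M.col j ∈ Submodule.span R (M.col '' {k | b j < b k})) :
    M'.det = (∏ j, u j) * M.det := by
  choose t ht hM using fun j => (Finsupp.mem_span_image_iff_linearCombination R).mp (h j)
  let T : Matrix ι ι R := Matrix.of fun k j => Matrix.diagonal u k j + t j k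
  have ht0 : ∀ j k, b k ≤ b j → t j k = 0 := fun j k hjk => by
    by_contra h0
    exact absurd ((Finsupp.mem_supported R (t j)).mp (ht j) (Finsupp.mem_support_iff.mpr h0))
      (not_lt.mpr hjk)
  have hMT : M' = M * T := by
    ext i j
    have h1 := congrFun (hM j) i
    rw [Finsupp.linearCombination_apply, Finsupp.sum_fintype _ _ (by simp)] at h1
    simp only [Finset.sum_apply, Pi.smul_apply, Matrix.col_apply, smul_eq_mul, Pi.sub_apply] at h1
    simp only [T, Matrix.mul_apply, Matrix.of_apply, mul_add, Finset.sum_add_distrib,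
      Matrix.diagonal_apply, mul_ite, mul_zero, Finset.sum_ite_eq', Finset.mem_univ, if_true]
    simp only [mul_comm] at h1 ⊢
    rw [h1]
    ring
  have hT : T.BlockTriangular (OrderDual.toDual ∘ b) := fun k j hkj => by
    have hlt : b k < b j := hkj
    have hne : k ≠ j := fun h => by simp [h] at hlt
    simp [T, Matrix.diagonal_apply_ne _ hne, ht0 j k hlt.le]
  -- Ties of `b` are harmless: within a block of equal `b` the matrix `T` is diagonal.
  have hblock : ∀ a, (T.toSquareBlock (OrderDual.toDual ∘ b) a).det =
      ∏ j : {j // (OrderDual.toDual ∘ b) j = a}, u j := fun a => by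
    rw [← Matrix.det_diagonal]
    congr 1
    ext k j
    have hkj : b k ≤ b j := le_of_eq (OrderDual.toDual.injective (k.2.trans j.2.symm))
    simp only [Matrix.toSquareBlock_def, T, Matrix.of_apply, ht0 _ _ hkj, add_zero,
      Matrix.diagonal_apply, Subtype.ext_iff]
  rw [hMT, Matrix.det_mul, hT.det, mul_comm]
  congr 1
  simp only [hblock]
  rw [← Finset.prod_fiberwise_of_maps_to (s := Finset.univ)
    (fun i _ => Finset.mem_image_of_mem (OrderDual.toDual ∘ b) (Finset.mem_univ i)) u]
  refine Finset.prod_congr rfl fun a _ => ?_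
  rw [Finset.prod_subtype (p := fun j => (OrderDual.toDual ∘ b) j = a)]
  simp

/-- The matrix with rows `(ψ_i f_i^k g_i^(p-1-k))_{k < p}, (χ_i f_i^k g_i^(q-1-k))_{k < q}`. -/
def hmat {ι R : Type*} [CommRing R] (p q : ℕ) (f g ψ χ : ι → R) :
    Matrix ι (Fin p ⊕ Fin q) R :=
  Matrix.of fun i => Sum.elim (fun k => ψ i * (f i ^ (k : ℕ) * g i ^ (k.rev : ℕ)))
    (fun k => χ i * (f i ^ (k : ℕ) * g i ^ (k.rev : ℕ)))

theorem Fin.append_update_left {M : Type*} {p q : ℕ} (v : Fin p → M) (w : Fin q → M) (i : Fin p)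
    (m : M) : Fin.append (Function.update v i m) w =
      Function.update (Fin.append v w) (Fin.castAdd q i) m := by
  ext j
  refine Fin.addCases (fun j => ?_) (fun j => ?_) j
  · rw [Fin.append_left]
    by_cases h : j = i
    · subst h; simp
    · rw [Function.update_of_ne h, Function.update_of_ne, Fin.append_left]
      simpa using h
  · rw [Fin.append_right, Function.update_of_ne, Fin.append_right]
    intro h
    have := congrArg Fin.val h
    simp at this
    omega

theorem Fin.append_update_right {M : Type*} {p q : ℕ} (v : Fin p → M) (w : Fin q → M) (i : Fin q)
    (m : M) : Fin.append v (Function.update w i m) =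
      Function.update (Fin.append v w) (Fin.natAdd p i) m := by
  ext j
  refine Fin.addCases (fun j => ?_) (fun j => ?_) j
  · rw [Fin.append_left, Function.update_of_ne, Fin.append_left]
    intro h
    have := congrArg Fin.val h
    simp at this
    omega
  · rw [Fin.append_right]
    by_cases h : j = i
    · subst h; simp
    · rw [Function.update_of_ne h, Function.update_of_ne, Fin.append_right]
      simpa using h

/-- An alternating map in the first `p` arguments, the others being fixed. -/
def alternatingFixRight {R M N : Type*} [CommRing R] [AddCommGroup M] [Module R M]
    [AddCommGroup N] [Module R N] {p q : ℕ} (Φ : M [⋀^Fin (p + q)]→ₗ[R] N) (w : Fin q → M) :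
    M [⋀^Fin p]→ₗ[R] N where
  toFun v := Φ (Fin.append v w)
  map_update_add' v i x y := by
    -- The field quantifies over an arbitrary `DecidableEq` instance, which is replaced by the
    -- standard one.
    rename_i inst
    rw [Subsingleton.elim inst (instDecidableEqFin p)]
    simp only [Fin.append_update_left, AlternatingMap.map_update_add]
  map_update_smul' v i x y := by
    rename_i inst
    rw [Subsingleton.elim inst (instDecidableEqFin p)]
    simp only [Fin.append_update_left, AlternatingMap.map_update_smul]
  map_eq_zero_of_eq' v i j h hij :=
    Φ.map_eq_zero_of_eq (i := Fin.castAdd q i) (j := Fin.castAdd q j) _ (by simpa using h)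
      (by simpa using hij)

/-- An alternating map in the last `q` arguments, the others being fixed. -/
def alternatingFixLeft {R M N : Type*} [CommRing R] [AddCommGroup M] [Module R M]
    [AddCommGroup N] [Module R N] {p q : ℕ} (Φ : M [⋀^Fin (p + q)]→ₗ[R] N) (v : Fin p → M) :
    M [⋀^Fin q]→ₗ[R] N where
  toFun w := Φ (Fin.append v w)
  map_update_add' w i x y := by
    rename_i inst
    rw [Subsingleton.elim inst (instDecidableEqFin q)]
    simp only [Fin.append_update_right, AlternatingMap.map_update_add]
  map_update_smul' w i x y := by
    rename_i inst
    rw [Subsingleton.elim inst (instDecidableEqFin q)]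
    simp only [Fin.append_update_right, AlternatingMap.map_update_smul]
  map_eq_zero_of_eq' w i j h hij :=
    Φ.map_eq_zero_of_eq (i := Fin.natAdd p i) (j := Fin.natAdd p j) _ (by simpa using h)
      (by simpa using hij)

/-- The column vectors whose determinant is `F`. -/
def symCol {R ι : Type*} [CommRing R] (p : ℕ) (x a : ι → R) (k : Fin p) : ι → R := fun i =>
  a i * if (k : ℕ) + 1 = p then x i ^ (k : ℕ) else x i ^ (k : ℕ) + x i ^ (2 * p - 2 - k)

/-- The sign factors by parity, so the sum over `mu` collapses with the first `p` columns fixed, and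
then the sum over `lam` with the last `q` columns fixed. -/
theorem F_eq_det_symCol {R : Type*} [CommRing R] (p q : ℕ) (x a : Fin (p + q) → R) :
    F p q x a = (Matrix.of fun i => Fin.append (fun k => symCol p x 1 k i)
      (fun k => symCol q x a k i)).det := by
  let Φ : (Fin (p + q) → R) [⋀^Fin (p + q)]→ₗ[R] R := Matrix.detRowAlternating
  let e : (Fin (p + q) → R) → ℕ → Fin (p + q) → R := fun a m i => a i * x i ^ m
  have hV : ∀ lam mu, (V p q lam mu x a).det = Φ (Fin.append
      (fun k : Fin p => e 1 (lam.rowLen k.rev + k)) (fun k : Fin q => e a (mu.rowLen k.rev + k))) := by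
    intro lam mu
    rw [← Matrix.det_transpose]
    refine congrArg Matrix.det ?_
    ext j i
    refine Fin.addCases (fun j => ?_) (fun j => ?_) j
    · simp [V, e]
    · simp [V, e]
  have h1 : ∀ lam ∈ P p, ∀ mu ∈ P q, (-1 : R) ^ ((lam.card + mu.card) / 2) =
      (-1) ^ (lam.card / 2) * (-1) ^ (mu.card / 2) := by
    intro lam hl mu hm
    obtain ⟨r, hr⟩ := even_card_of_mem_P hl
    obtain ⟨s, hs⟩ := even_card_of_mem_P hm
    rw [← pow_add]
    congr 1
    omega
  have h2 : F p q x a = ∑ lam ∈ P p, (-1 : R) ^ (lam.card / 2) • ∑ mu ∈ P q,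
      (-1 : R) ^ (mu.card / 2) • alternatingFixLeft Φ
        (fun k : Fin p => e 1 (lam.rowLen k.rev + k)) fun k : Fin q => e a (mu.rowLen k.rev + k) := by
    rw [F]
    refine Finset.sum_congr rfl fun lam hl => ?_
    rw [Finset.smul_sum]
    refine Finset.sum_congr rfl fun mu hm => ?_
    rw [h1 lam hl mu hm, hV, mul_assoc]
    rfl
  simp only [sum_P_alternatingMap] at h2
  have h3 := sum_P_alternatingMap p (alternatingFixRight Φ
    fun k : Fin q => if (k : ℕ) + 1 = q then e a k else e a k + e a (2 * q - 2 - k)) (e 1)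
  refine h2.trans (h3.trans ?_)
  rw [← Matrix.det_transpose]
  refine congrArg Matrix.det ?_
  ext j i
  refine Fin.addCases (fun j => ?_) (fun j => ?_) j
  · simp only [Fin.append_left, e, symCol, Matrix.transpose_apply, Matrix.of_apply]
    split_ifs <;> simp
  · simp only [Fin.append_right, e, symCol, Matrix.transpose_apply, Matrix.of_apply]
    split_ifs <;> simp [mul_add]

/-- `1 + t^(2m)` in terms of `t^l (1 + t^2)^(m - l)`, uniformly in `t`. -/
theorem exists_one_add_pow_expansion {R : Type*} [CommRing R] : ∀ m : ℕ, 0 < m → ∃ c : ℕ → R,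
    ∀ t : R, 1 + t ^ (2 * m) = (1 + t ^ 2) ^ m +
      ∑ l ∈ Finset.range m, c l * (t ^ (l + 1) * (1 + t ^ 2) ^ (m - (l + 1))) := by
  intro m
  induction m using Nat.strong_induction_on with
  | _ m ih =>
    intro hm
    match m, hm with
    | 1, _ => exact ⟨0, fun t => by simp⟩
    | 2, _ => exact ⟨fun l => if l = 1 then -2 else 0, fun t => by
        simp; ring⟩
    | m + 3, _ =>
      obtain ⟨c, hc⟩ := ih (m + 2) (by omega) (by omega)
      obtain ⟨d, hd⟩ := ih (m + 1) (by omega) (by omega)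
      -- The coefficients come from the recurrence `h1`: multiplying by `1 + t^2` keeps the index of
      -- `c`, multiplying by `t^2` shifts `d` by two, and the leading term of the `d`-expansion
      -- becomes the `-1` at `l = 1`.
      refine ⟨fun l => (if l < m + 2 then c l else 0) - (if l = 1 then 1 else 0) -
        (if 2 ≤ l then d (l - 2) else 0), fun t => ?_⟩
      have h1 : 1 + t ^ (2 * (m + 3)) = (1 + t ^ 2) * (1 + t ^ (2 * (m + 2))) -
          t ^ 2 * (1 + t ^ (2 * (m + 1))) := by ring
      rw [h1, hc, hd]
      simp only [sub_mul, Finset.sum_sub_distrib]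
      have e1 : ∑ l ∈ Finset.range (m + 3), (if l < m + 2 then c l else 0) *
          (t ^ (l + 1) * (1 + t ^ 2) ^ (m + 3 - (l + 1))) = (1 + t ^ 2) *
          ∑ l ∈ Finset.range (m + 2), c l * (t ^ (l + 1) * (1 + t ^ 2) ^ (m + 2 - (l + 1))) := by
        rw [Finset.sum_range_succ, Finset.mul_sum]
        simp only [lt_irrefl, if_false, zero_mul, add_zero]
        refine Finset.sum_congr rfl fun l hl => ?_
        rw [Finset.mem_range] at hl
        rw [if_pos hl, show m + 3 - (l + 1) = m + 2 - (l + 1) + 1 by omega, pow_succ]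
        ring
      have e2 : ∑ l ∈ Finset.range (m + 3), (if l = 1 then (1 : R) else 0) *
          (t ^ (l + 1) * (1 + t ^ 2) ^ (m + 3 - (l + 1))) = t ^ 2 * (1 + t ^ 2) ^ (m + 1) := by
        rw [Finset.sum_eq_single_of_mem 1 (by simp)]
        · simp
        · intro l _ hl
          simp [hl]
      have e3 : ∑ l ∈ Finset.range (m + 3), (if 2 ≤ l then d (l - 2) else 0) *
          (t ^ (l + 1) * (1 + t ^ 2) ^ (m + 3 - (l + 1))) = t ^ 2 *
          ∑ l ∈ Finset.range (m + 1), d l * (t ^ (l + 1) * (1 + t ^ 2) ^ (m + 1 - (l + 1))) := by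
        rw [Finset.sum_range_succ', Finset.sum_range_succ', Finset.mul_sum]
        simp only [zero_add, Nat.reduceLeDiff, if_false, zero_mul, add_zero, nonpos_iff_eq_zero,
          OfNat.ofNat_ne_zero]
        refine Finset.sum_congr rfl fun l hl => ?_
        rw [if_pos trivial, show l + 1 + 1 - 2 = l by omega,
          show m + 3 - (l + 1 + 1 + 1) = m + 1 - (l + 1) by omega]
        ring
      rw [e1, e2, e3]
      ring

/-- Factor out `x^k` and expand `1 + x^(2(p-1-k))`: each correction has a larger exponent of `x`,
hence is a later column. The coefficients are the same in every row, as a column operation requires.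
-/
theorem symCol_sub_mem_span {R ι : Type*} [CommRing R] {p : ℕ} (x a : ι → R) (k : Fin p) :
    symCol p x a k - (fun i => a i * (x i ^ (k : ℕ) * (1 + x i ^ 2) ^ (k.rev : ℕ))) ∈
      Submodule.span R ((fun (l : Fin p) i => a i * (x i ^ (l : ℕ) * (1 + x i ^ 2) ^ (l.rev : ℕ))) ''
        {l | k < l}) := by
  have hk := k.2
  by_cases h : (k : ℕ) + 1 = p
  · convert Submodule.zero_mem _
    ext i
    simp only [symCol, h, if_true, Pi.sub_apply, Fin.val_rev]
    simp
  · obtain ⟨c, hc⟩ := exists_one_add_pow_expansion (R := R) (p - 1 - k) (by omega)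
    have h1 : symCol p x a k - (fun i => a i * (x i ^ (k : ℕ) * (1 + x i ^ 2) ^ (k.rev : ℕ))) =
        ∑ l ∈ Finset.range (p - 1 - k), c l • fun i =>
          a i * (x i ^ ((k : ℕ) + l + 1) * (1 + x i ^ 2) ^ (p - 1 - k - (l + 1))) := by
      ext i
      simp only [symCol, h, if_false, Pi.sub_apply, Fin.val_rev, Finset.sum_apply, Pi.smul_apply,
        smul_eq_mul]
      have h2 : x i ^ (k : ℕ) + x i ^ (2 * p - 2 - k) =
          x i ^ (k : ℕ) * (1 + x i ^ (2 * (p - 1 - k))) := by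
        rw [mul_add, mul_one, ← pow_add]
        congr 2
        omega
      rw [h2, hc, show p - (k + 1) = p - 1 - k by omega]
      rw [mul_add, mul_add, add_sub_cancel_left, Finset.mul_sum, Finset.mul_sum]
      refine Finset.sum_congr rfl fun l _ => ?_
      ring
    rw [h1]
    refine Submodule.sum_mem _ fun l hl => Submodule.smul_mem _ _ (Submodule.subset_span ?_)
    rw [Finset.mem_range] at hl
    refine ⟨⟨k + l + 1, by omega⟩, ?_, ?_⟩
    · show (k : ℕ) < k + l + 1
      omega
    · ext i
      simp only [Fin.val_rev]
      congr 3
      omega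

theorem F_eq_det_hmat {R : Type*} [CommRing R] (p q : ℕ) (x a : Fin (p + q) → R) :
    F p q x a = ((hmat p q x (fun i => 1 + x i ^ 2) 1 a).submatrix id finSumFinEquiv.symm).det := by
  rw [F_eq_det_symCol, det_eq_of_triangular_columns
    ((hmat p q x (fun i => 1 + x i ^ 2) 1 a).submatrix id finSumFinEquiv.symm) _ 1
    (fun j => Sum.elim (fun k : Fin p => (k : ℕ)) (fun k : Fin q => (k : ℕ)) (finSumFinEquiv.symm j))]
  · simp
  intro j
  rw [Pi.one_apply, one_smul]
  refine Fin.addCases (fun j => ?_) (fun j => ?_) j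
  · have h := symCol_sub_mem_span x 1 j
    refine Submodule.span_mono ?_ (Eq.subst (motive := fun v => v ∈ _) ?_ h)
    · rintro _ ⟨l, hl, rfl⟩
      refine ⟨Fin.castAdd q l, by simpa using hl, ?_⟩
      ext i
      simp [hmat]
    · ext i
      simp [hmat]
  · have h := symCol_sub_mem_span x a j
    refine Submodule.span_mono ?_ (Eq.subst (motive := fun v => v ∈ _) ?_ h)
    · rintro _ ⟨l, hl, rfl⟩
      refine ⟨Fin.natAdd p l, by simpa using hl, ?_⟩
      ext i
      simp [hmat]
    · ext i
      simp [hmat]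

/-! ### Elimination of the parameters `z` and `c` -/

/-- Four consecutive blocks of lengths `n, n, p, q`. -/
def blockRows (n p q : ℕ) : (Fin n ⊕ Fin n) ⊕ (Fin p ⊕ Fin q) ≃ Fin (n + p + (n + q)) :=
  (Equiv.sumCongr finSumFinEquiv finSumFinEquiv).trans
    (finSumFinEquiv.trans (finCongr (by omega)))

/-- The four blocks of `blockRows`, regrouped in the order first, third; second, fourth. -/
def blockCols (n p q : ℕ) : (Fin n ⊕ Fin n) ⊕ (Fin p ⊕ Fin q) ≃ Fin (n + p) ⊕ Fin (n + q) :=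
  (Equiv.sumSumSumComm _ _ _ _).trans (Equiv.sumCongr finSumFinEquiv finSumFinEquiv)

theorem blockCols_inl_inl {n p q : ℕ} (k : Fin n) :
    blockCols n p q (Sum.inl (Sum.inl k)) = Sum.inl (Fin.castAdd p k) := rfl

theorem blockCols_inl_inr {n p q : ℕ} (k : Fin n) :
    blockCols n p q (Sum.inl (Sum.inr k)) = Sum.inr (Fin.castAdd q k) := rfl

theorem blockCols_inr_inl {n p q : ℕ} (k : Fin p) :
    blockCols n p q (Sum.inr (Sum.inl k)) = Sum.inl (Fin.natAdd n k) := rfl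

theorem blockCols_inr_inr {n p q : ℕ} (k : Fin q) :
    blockCols n p q (Sum.inr (Sum.inr k)) = Sum.inr (Fin.natAdd n k) := rfl

/-- The inversions are exactly the `n * p` pairs of an index in the second block and one in the
third. -/
theorem sign_blockRows_blockCols (n p q : ℕ) :
    Equiv.Perm.sign ((blockRows n p q).symm.trans ((blockCols n p q).trans finSumFinEquiv)) =
      (-1) ^ (n * p) := by
  set σ : Equiv.Perm (Fin (n + p + (n + q))) :=
    (blockRows n p q).symm.trans ((blockCols n p q).trans finSumFinEquiv) with hσ
  have hval : ∀ s, (σ (blockRows n p q s) : ℕ) = finSumFinEquiv (blockCols n p q s) := by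
    intro s
    simp [hσ]
  have h1 : ∀ i, (σ i : ℕ) = if (i : ℕ) < n then (i : ℕ) else if (i : ℕ) < n + n then (i : ℕ) + p
      else if (i : ℕ) < n + n + p then (i : ℕ) - n else (i : ℕ) := by
    intro i
    obtain ⟨s, rfl⟩ := (blockRows n p q).surjective i
    rw [hval]
    rcases s with (k | k) | (k | k) <;> have hk := k.2 <;>
      simp [blockRows, blockCols] <;> (try split_ifs) <;> omega
  have h2 : ∀ i j, (if i < j then (if σ i < σ j then (1 : ℤˣ) else -1) else 1) =
      if (n ≤ (i : ℕ) ∧ (i : ℕ) < n + n) then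
        if (n + n ≤ (j : ℕ) ∧ (j : ℕ) < n + n + p) then -1 else 1 else 1 := by
    intro i j
    have hi := h1 i
    have hj := h1 j
    simp only [Fin.lt_def]
    split_ifs at hi hj ⊢ <;> first | rfl | (exfalso; omega)
  have h3 : ∀ i, ∏ j ∈ Finset.Ioi i, (if σ i < σ j then (1 : ℤˣ) else -1) =
      ∏ j, if i < j then (if σ i < σ j then (1 : ℤˣ) else -1) else 1 := by
    intro i
    rw [← Finset.prod_filter]
    congr 1
    ext j
    simp
  rw [Equiv.Perm.sign_eq_prod_prod_Ioi]
  simp only [h3, h2]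
  have h4 : ∀ (lo len : ℕ) (u : ℤˣ), lo + len ≤ n + p + (n + q) →
      ∏ j : Fin (n + p + (n + q)), (if (lo ≤ (j : ℕ) ∧ (j : ℕ) < lo + len) then u else 1) =
        u ^ len := by
    intro lo len u hle
    rw [Fin.prod_univ_eq_prod_range (fun j => if (lo ≤ j ∧ j < lo + len) then u else 1),
      ← Finset.prod_filter, Finset.prod_const]
    congr 1
    have : (Finset.range (n + p + (n + q))).filter (fun j => lo ≤ j ∧ j < lo + len) =
        Finset.Ico lo (lo + len) := by
      ext j
      simp only [Finset.mem_filter, Finset.mem_range, Finset.mem_Ico]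
      omega
    rw [this, Nat.card_Ico, Nat.add_sub_cancel_left]
  have h5 : ∀ i : Fin (n + p + (n + q)), (∏ j : Fin (n + p + (n + q)),
      if (n ≤ (i : ℕ) ∧ (i : ℕ) < n + n) then
        if (n + n ≤ (j : ℕ) ∧ (j : ℕ) < n + n + p) then (-1 : ℤˣ) else 1 else 1) =
      if (n ≤ (i : ℕ) ∧ (i : ℕ) < n + n) then (-1) ^ p else 1 := by
    intro i
    split_ifs with h
    · exact h4 _ _ _ (by omega)
    · exact Finset.prod_const_one
  simp only [h5]
  rw [h4 _ _ _ (by omega), ← pow_mul, mul_comm]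

theorem det_submatrix_equiv_equiv {m n R : Type*} [Fintype m] [DecidableEq m] [Fintype n]
    [DecidableEq n] [CommRing R] (M : Matrix n n R) (e f : m ≃ n) :
    (M.submatrix e f).det = (Equiv.Perm.sign (e.symm.trans f) : ℤ) * M.det := by
  have h : M.submatrix e f = (M.submatrix id (e.symm.trans f)).submatrix e e := by
    ext i j
    simp
  rw [h, Matrix.det_submatrix_equiv_self, Matrix.det_permute']

/-- The row of `hmat` at the point `(x, 1 + x ^ 2)`. -/
def hrow {R : Type*} [CommRing R] (p q : ℕ) (x a : R) : Fin p ⊕ Fin q → R :=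
  Sum.elim (fun k => x ^ (k : ℕ) * (1 + x ^ 2) ^ (k.rev : ℕ))
    (fun k => a * (x ^ (k : ℕ) * (1 + x ^ 2) ^ (k.rev : ℕ)))

/-- The determinant of `hmat n n` with rows numbered by `Fin (n + n)`. -/
def core {R : Type*} [CommRing R] (n : ℕ) (f g ψ χ : Fin (n + n) → R) : R :=
  ((hmat n n f g ψ χ).submatrix id finSumFinEquiv.symm).det

theorem hrow_blockCols_inl_inl {R : Type*} [CommRing R] {n p q : ℕ} (x a : R) (k : Fin n) :
    hrow (n + p) (n + q) x a (blockCols n p q (Sum.inl (Sum.inl k))) =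
      x ^ (k : ℕ) * (1 + x ^ 2) ^ (k.rev : ℕ) * (1 + x ^ 2) ^ p := by
  have hk := k.2
  simp only [blockCols_inl_inl, hrow, Sum.elim_inl, Fin.val_castAdd, Fin.val_rev]
  rw [mul_assoc, ← pow_add]
  congr 2
  omega

theorem hrow_blockCols_inl_inr {R : Type*} [CommRing R] {n p q : ℕ} (x a : R) (k : Fin n) :
    hrow (n + p) (n + q) x a (blockCols n p q (Sum.inl (Sum.inr k))) =
      x ^ (k : ℕ) * (1 + x ^ 2) ^ (k.rev : ℕ) * (a * (1 + x ^ 2) ^ q) := by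
  have hk := k.2
  simp only [blockCols_inl_inr, hrow, Sum.elim_inr, Fin.val_castAdd, Fin.val_rev]
  rw [show n + q - (k + 1) = n - (k + 1) + q by omega]
  ring

theorem hrow_blockCols_inr {R : Type*} [CommRing R] {n p q : ℕ} (x a : R) (t : Fin p ⊕ Fin q) :
    hrow (n + p) (n + q) x a (blockCols n p q (Sum.inr t)) = x ^ n * hrow p q x a t := by
  rcases t with t | t <;> have ht := t.2
  · simp only [blockCols_inr_inl, hrow, Sum.elim_inl, Fin.val_natAdd, Fin.val_rev]
    rw [show n + p - (n + t + 1) = p - (t + 1) by omega]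
    ring
  · simp only [blockCols_inr_inr, hrow, Sum.elim_inr, Fin.val_natAdd, Fin.val_rev]
    rw [show n + q - (n + t + 1) = q - (t + 1) by omega]
    ring

theorem F_eq_det_hrow {R : Type*} [CommRing R] (p q : ℕ) (x a : Fin (p + q) → R) :
    F p q x a = (Matrix.of fun s : Fin p ⊕ Fin q =>
      hrow p q (x (finSumFinEquiv s)) (a (finSumFinEquiv s))).det := by
  rw [F_eq_det_hmat, ← Matrix.det_submatrix_equiv_self finSumFinEquiv]
  congr 1
  ext s t
  rcases t with t | t <;> simp [hmat, hrow]

/-- `C` solves a square linear system whose determinant is `F p q z c`. The factor `z k` reflects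
that a correction must raise the exponent of `x` in order to be a triangular operation; dividing by
it needs `z k ≠ 0`. -/
theorem exists_vanishing {K : Type*} [Field K] {p q : ℕ} {z c : Fin (p + q) → K}
    (hD : F p q z c ≠ 0) (hz : ∀ k, z k ≠ 0) (v : Fin (p + q) → K) :
    ∃ C : Fin p ⊕ Fin q → K, ∀ k, v k + z k * ∑ s, C s * hrow p q (z k) (c k) s = 0 := by
  rw [F_eq_det_hrow] at hD
  set H : Matrix (Fin p ⊕ Fin q) (Fin p ⊕ Fin q) K := Matrix.of fun s =>
    hrow p q (z (finSumFinEquiv s)) (c (finSumFinEquiv s)) with hH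
  refine ⟨H⁻¹.mulVec fun s => -(v (finSumFinEquiv s)) / z (finSumFinEquiv s), fun k => ?_⟩
  obtain ⟨s, rfl⟩ := finSumFinEquiv.surjective k
  have h : (H.mulVec (H⁻¹.mulVec fun s => -(v (finSumFinEquiv s)) / z (finSumFinEquiv s))) s =
      -(v (finSumFinEquiv s)) / z (finSumFinEquiv s) := by
    rw [Matrix.mulVec_mulVec, Matrix.mul_nonsing_inv _ (isUnit_iff_ne_zero.mpr hD),
      Matrix.one_mulVec]
  rw [Matrix.mulVec, dotProduct] at h
  simp only [hH, Matrix.of_apply] at h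
  simp only [mul_comm (Matrix.mulVec _ _ _)]
  rw [h]
  field_simp [hz (finSumFinEquiv s)]
  ring

/-- Thanks to the extra factor `x`, the monomial of exponent `k` times that of exponent `l` is the
column of exponent `k + 1 + l > k`. -/
theorem hrow_mul_mem_span {ι R : Type*} [CommRing R] {n p q : ℕ} (x a : ι → R)
    (C : Fin p ⊕ Fin q → R) (k : Fin n) :
    (fun i => x i ^ (k : ℕ) * (1 + x i ^ 2) ^ (k.rev : ℕ) *
        (x i * ∑ s, C s * hrow p q (x i) (a i) s)) ∈
      Submodule.span R ((fun (s : (Fin n ⊕ Fin n) ⊕ (Fin p ⊕ Fin q)) i =>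
        hrow (n + p) (n + q) (x i) (a i) (blockCols n p q s)) ''
          {s | (k : ℕ) < Sum.elim (fun m : Fin (n + p) => (m : ℕ)) (fun m : Fin (n + q) => (m : ℕ))
            (blockCols n p q s)}) := by
  have hk := k.2
  have h : (fun i => x i ^ (k : ℕ) * (1 + x i ^ 2) ^ (k.rev : ℕ) *
        (x i * ∑ s, C s * hrow p q (x i) (a i) s)) =
      ∑ s, C s • fun i => x i ^ (k : ℕ) * (1 + x i ^ 2) ^ (k.rev : ℕ) *
        (x i * hrow p q (x i) (a i) s) := by
    ext i
    simp only [Finset.sum_apply, Pi.smul_apply, smul_eq_mul, Finset.mul_sum]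
    refine Finset.sum_congr rfl fun s _ => ?_
    ring
  rw [h]
  refine Submodule.sum_mem _ fun s _ => Submodule.smul_mem _ _ (Submodule.subset_span ?_)
  rcases s with l | l
  · have hl := l.2
    refine ⟨(blockCols n p q).symm (Sum.inl ⟨k + 1 + l, by omega⟩), ?_, ?_⟩
    · simp only [Set.mem_ofPred_eq, Equiv.apply_symm_apply, Sum.elim_inl]
      omega
    · ext i
      simp only [Equiv.apply_symm_apply, hrow, Sum.elim_inl, Fin.val_rev]
      rw [show n + p - (k + 1 + l + 1) = (n - (k + 1)) + (p - (l + 1)) by omega]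
      ring
  · have hl := l.2
    refine ⟨(blockCols n p q).symm (Sum.inr ⟨k + 1 + l, by omega⟩), ?_, ?_⟩
    · simp only [Set.mem_ofPred_eq, Equiv.apply_symm_apply, Sum.elim_inr]
      omega
    · ext i
      simp only [Equiv.apply_symm_apply, hrow, Sum.elim_inr, Fin.val_rev]
      rw [show n + q - (k + 1 + l + 1) = (n - (k + 1)) + (q - (l + 1)) by omega]
      ring

/-- `φ₁` and `φ₂` are `(1+x^2)^p` and `a (1+x^2)^q`, corrected so as to vanish at every `(z k, c
k)`. Column operations insert them into the first `n` columns of each family, and the matrix becomes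
block triangular. They are chosen before `n`, which later lets the case `n = 1` describe the
entries. -/
theorem exists_F_append_eq {K : Type*} [Field K] {p q : ℕ} {z c : Fin (p + q) → K}
    (hD : F p q z c ≠ 0) (hz : ∀ k, z k ≠ 0) :
    ∃ φ₁ φ₂ : K → K → K, ∀ (n : ℕ) (x a : Fin (n + n) → K),
      F (n + p) (n + q) (Fin.append x z ∘ Fin.cast (Nat.add_add_add_comm n p n q))
          (Fin.append a c ∘ Fin.cast (Nat.add_add_add_comm n p n q)) =
        (-1) ^ (n * p) * core n x (fun i => 1 + x i ^ 2) (fun i => φ₁ (x i) (a i))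
          (fun i => φ₂ (x i) (a i)) * ((∏ k, z k) ^ n * F p q z c) := by
  obtain ⟨C₁, hC₁⟩ := exists_vanishing hD hz fun k => (1 + z k ^ 2) ^ p
  obtain ⟨C₂, hC₂⟩ := exists_vanishing hD hz fun k => c k * (1 + z k ^ 2) ^ q
  let φ₁ : K → K → K := fun x a => (1 + x ^ 2) ^ p + x * ∑ s, C₁ s * hrow p q x a s
  let φ₂ : K → K → K := fun x a => a * (1 + x ^ 2) ^ q + x * ∑ s, C₂ s * hrow p q x a s
  refine ⟨φ₁, φ₂, fun n x a => ?_⟩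
  set X : (Fin n ⊕ Fin n) ⊕ (Fin p ⊕ Fin q) → K :=
    Sum.elim (x ∘ finSumFinEquiv) (z ∘ finSumFinEquiv) with hX
  set A : (Fin n ⊕ Fin n) ⊕ (Fin p ⊕ Fin q) → K :=
    Sum.elim (a ∘ finSumFinEquiv) (c ∘ finSumFinEquiv) with hA
  have happ : ∀ (u : Fin (n + n) → K) (w : Fin (p + q) → K) s,
      (Fin.append u w ∘ Fin.cast (Nat.add_add_add_comm n p n q)) (blockRows n p q s) =
        Sum.elim (u ∘ finSumFinEquiv) (w ∘ finSumFinEquiv) s := by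
    intro u w s
    rcases s with s | s <;> simp [blockRows]
  set N : Matrix ((Fin n ⊕ Fin n) ⊕ (Fin p ⊕ Fin q)) ((Fin n ⊕ Fin n) ⊕ (Fin p ⊕ Fin q)) K :=
    Matrix.of fun s t => hrow (n + p) (n + q) (X s) (A s) (blockCols n p q t) with hN
  have hF : F (n + p) (n + q) (Fin.append x z ∘ Fin.cast (Nat.add_add_add_comm n p n q))
      (Fin.append a c ∘ Fin.cast (Nat.add_add_add_comm n p n q)) = (-1) ^ (n * p) * N.det := by
    have h := det_submatrix_equiv_equiv ((hmat (n + p) (n + q)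
      (Fin.append x z ∘ Fin.cast (Nat.add_add_add_comm n p n q))
      (fun i => 1 + (Fin.append x z ∘ Fin.cast (Nat.add_add_add_comm n p n q)) i ^ 2) 1
      (Fin.append a c ∘ Fin.cast (Nat.add_add_add_comm n p n q))).submatrix id finSumFinEquiv.symm)
      (blockRows n p q) ((blockCols n p q).trans finSumFinEquiv)
    rw [sign_blockRows_blockCols, ← F_eq_det_hmat] at h
    have h' : N = (((hmat (n + p) (n + q)
      (Fin.append x z ∘ Fin.cast (Nat.add_add_add_comm n p n q))
      (fun i => 1 + (Fin.append x z ∘ Fin.cast (Nat.add_add_add_comm n p n q)) i ^ 2) 1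
      (Fin.append a c ∘ Fin.cast (Nat.add_add_add_comm n p n q))).submatrix id finSumFinEquiv.symm).submatrix
      (blockRows n p q) ((blockCols n p q).trans finSumFinEquiv)) := by
      ext s t
      simp only [hN, Matrix.of_apply, Matrix.submatrix_apply, Equiv.trans_apply,
        Equiv.symm_apply_apply, id, hmat, happ, hrow, Pi.one_apply, one_mul, hX, hA]
    rw [h', h, ← mul_assoc]
    push_cast
    rw [← mul_pow, neg_one_mul, neg_neg, one_pow, one_mul]
  set N' : Matrix ((Fin n ⊕ Fin n) ⊕ (Fin p ⊕ Fin q)) ((Fin n ⊕ Fin n) ⊕ (Fin p ⊕ Fin q)) K :=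
    Matrix.of fun s => Sum.elim (Sum.elim
      (fun k => X s ^ (k : ℕ) * (1 + X s ^ 2) ^ (k.rev : ℕ) * φ₁ (X s) (A s))
      (fun k => X s ^ (k : ℕ) * (1 + X s ^ 2) ^ (k.rev : ℕ) * φ₂ (X s) (A s)))
      (fun t => N s (Sum.inr t)) with hN'
  have hdet : N'.det = N.det := by
    rw [det_eq_of_triangular_columns N N' 1 fun t => Sum.elim (fun m : Fin (n + p) => (m : ℕ))
      (fun m : Fin (n + q) => (m : ℕ)) (blockCols n p q t)]
    · simp
    intro t
    rw [Pi.one_apply, one_smul]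
    rcases t with (k | k) | t
    · have h := hrow_mul_mem_span X A C₁ k
      refine Submodule.span_mono (le_of_eq ?_) (Eq.subst (motive := fun v => v ∈ _) ?_ h)
      · refine congrArg₂ _ rfl ?_
        simp [blockCols]
      · have hk := k.2
        ext s
        simp only [N', N, φ₁, Pi.sub_apply, Matrix.col_apply, Matrix.of_apply, Sum.elim_inl,
          hrow_blockCols_inl_inl]
        ring
    · have h := hrow_mul_mem_span X A C₂ k
      refine Submodule.span_mono (le_of_eq ?_) (Eq.subst (motive := fun v => v ∈ _) ?_ h)
      · refine congrArg₂ _ rfl ?_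
        simp [blockCols]
      · have hk := k.2
        ext s
        simp only [N', N, φ₂, Pi.sub_apply, Matrix.col_apply, Matrix.of_apply, Sum.elim_inl,
          Sum.elim_inr, hrow_blockCols_inl_inr]
        ring
    · convert Submodule.zero_mem _
      ext s
      simp [N']
  -- All remaining columns carry the factor `x ^ n`, so the corner at the rows of `z` has
  -- determinant `(∏ k, z k) ^ n * F p q z c`.
  have hblock : N' = Matrix.fromBlocks
      (((hmat n n x (fun i => 1 + x i ^ 2) (fun i => φ₁ (x i) (a i))
        (fun i => φ₂ (x i) (a i))).submatrix finSumFinEquiv id)) (Matrix.of fun s t => N (Sum.inl s) (Sum.inr t))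
      0 (Matrix.of fun s t => z (finSumFinEquiv s) ^ n *
        hrow p q (z (finSumFinEquiv s)) (c (finSumFinEquiv s)) t) := by
    ext s t
    rcases s with s | s <;> rcases t with (t | t) | t
    · simp [N', X, A, hmat]; ring
    · simp [N', X, A, hmat]; ring
    · simp [N']
    · simp only [N', X, A, φ₁, Matrix.of_apply, Sum.elim_inr, Sum.elim_inl, Function.comp_apply,
        hC₁, mul_zero, Matrix.fromBlocks_apply₂₁, Matrix.zero_apply]
    · simp only [N', X, A, φ₂, Matrix.of_apply, Sum.elim_inr, Sum.elim_inl, Function.comp_apply,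
        hC₂, mul_zero, Matrix.fromBlocks_apply₂₁, Matrix.zero_apply]
    · simp only [N', N, X, A, Matrix.of_apply, Sum.elim_inr, Function.comp_apply,
        Matrix.fromBlocks_apply₂₂, hrow_blockCols_inr]
  have hcore : ((hmat n n x (fun i => 1 + x i ^ 2) (fun i => φ₁ (x i) (a i))
        (fun i => φ₂ (x i) (a i))).submatrix finSumFinEquiv id).det =
      core n x (fun i => 1 + x i ^ 2) (fun i => φ₁ (x i) (a i)) (fun i => φ₂ (x i) (a i)) := by
    rw [core, ← Matrix.det_submatrix_equiv_self finSumFinEquiv]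
    congr 1
    ext s t
    simp
  have hD' := Matrix.det_mul_column (fun s => z (finSumFinEquiv s) ^ n)
    (Matrix.of fun s => hrow p q (z (finSumFinEquiv s)) (c (finSumFinEquiv s)))
  rw [← F_eq_det_hrow, finSumFinEquiv.prod_comp (fun k => z k ^ n), Finset.prod_pow] at hD'
  simp only [Matrix.of_apply] at hD'
  rw [hF, ← hdet, hblock, Matrix.det_fromBlocks_zero₂₁, hcore, hD', mul_assoc]

theorem core_one {R : Type*} [CommRing R] (f g ψ χ : Fin 2 → R) :
    core 1 f g ψ χ = ψ 0 * χ 1 - ψ 1 * χ 0 := by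
  rw [core, Matrix.det_fin_two]
  have h0 : (finSumFinEquiv (m := 1) (n := 1)).symm 0 = Sum.inl 0 := rfl
  have h1 : (finSumFinEquiv (m := 1) (n := 1)).symm 1 = Sum.inr 0 := rfl
  simp [hmat, h0, h1]
  ring

/-! ### Binary forms and the generalized Cauchy determinant -/

/-- Binary forms of degree `m`, as functions of the pair of variables. -/
def forms (R : Type*) [CommRing R] (m : ℕ) : Submodule R (R × R → R) :=
  Submodule.span R (Set.range fun (k : Fin (m + 1)) v => v.1 ^ (k : ℕ) * v.2 ^ (k.rev : ℕ))

theorem mem_forms_iff {R : Type*} [CommRing R] {m : ℕ} {P : R × R → R} : P ∈ forms R m ↔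
    ∃ c : Fin (m + 1) → R, ∀ v, P v = ∑ k : Fin (m + 1), v.1 ^ (k : ℕ) * v.2 ^ (k.rev : ℕ) * c k := by
  rw [forms, Submodule.mem_span_range_iff_exists_fun]
  refine exists_congr fun c => ?_
  rw [eq_comm, funext_iff]
  simp [mul_comm]

theorem monomial_mem_forms {R : Type*} [CommRing R] {m : ℕ} (k : Fin (m + 1)) :
    (fun v : R × R => v.1 ^ (k : ℕ) * v.2 ^ (k.rev : ℕ)) ∈ forms R m :=
  Submodule.subset_span ⟨k, rfl⟩

theorem mul_mem_forms {R : Type*} [CommRing R] {m n : ℕ} {P Q : R × R → R} (hP : P ∈ forms R m)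
    (hQ : Q ∈ forms R n) : P * Q ∈ forms R (m + n) := by
  have h := Submodule.mul_mem_mul hP hQ
  rw [forms, forms, Submodule.span_mul_span] at h
  refine Submodule.span_le.mpr ?_ h
  rintro _ ⟨_, ⟨k, rfl⟩, _, ⟨l, rfl⟩, rfl⟩
  have hk := k.2
  have hl := l.2
  refine Eq.subst (motive := fun P => P ∈ forms R (m + n)) ?_
    (monomial_mem_forms (⟨k + l, by omega⟩ : Fin (m + n + 1)))
  ext v
  simp only [Pi.mul_apply, Fin.val_rev]
  rw [show m + n + 1 - (k + l + 1) = m + 1 - (k + 1) + (n + 1 - (l + 1)) by omega]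
  ring

theorem linear_mem_forms {R : Type*} [CommRing R] (A B : R) :
    (fun v : R × R => A * v.2 - v.1 * B) ∈ forms R 1 :=
  mem_forms_iff.mpr ⟨![A, -B], fun v => by simp [Fin.sum_univ_two]; ring⟩

theorem prod_linear_mem_forms {R κ : Type*} [CommRing R] (s : Finset κ) (A B : κ → R) :
    (fun v : R × R => ∏ k ∈ s, (A k * v.2 - v.1 * B k)) ∈ forms R s.card := by
  classical
  induction s using Finset.induction_on with
  | empty => exact (mem_forms_iff (m := 0)).mpr ⟨1, fun v => by simp⟩
  | insert a s ha ih =>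
    rw [Finset.card_insert_of_notMem ha, add_comm]
    convert mul_mem_forms (linear_mem_forms (A a) (B a)) ih using 1
    ext v
    rw [Finset.prod_insert ha]
    rfl

/-- Regrouping the indices by `k` gives a block diagonal matrix with 2×2 blocks. -/
theorem det_fromBlocks_diagonal {n R : Type*} [Fintype n] [DecidableEq n] [CommRing R]
    (a b c d : n → R) :
    (Matrix.fromBlocks (Matrix.diagonal a) (Matrix.diagonal b) (Matrix.diagonal c)
      (Matrix.diagonal d)).det = ∏ k, (a k * d k - b k * c k) := by
  let e : Fin 2 × n ≃ n ⊕ n :=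
    (Equiv.prodCongr finTwoEquiv (Equiv.refl n)).trans (Equiv.boolProdEquivSum n)
  rw [← Matrix.det_submatrix_equiv_self e]
  have h : (Matrix.fromBlocks (Matrix.diagonal a) (Matrix.diagonal b) (Matrix.diagonal c)
      (Matrix.diagonal d)).submatrix e e =
      Matrix.blockDiagonal fun k => !![a k, b k; c k, d k] := by
    ext ⟨i, k⟩ ⟨j, l⟩
    have h0 : finTwoEquiv 0 = false := rfl
    have h1 : finTwoEquiv 1 = true := rfl
    fin_cases i <;> fin_cases j <;>
      simp [e, h0, h1, Matrix.blockDiagonal_apply, Equiv.boolProdEquivSum, Matrix.diagonal_apply]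
  rw [h, Matrix.det_blockDiagonal]
  simp [Matrix.det_fin_two]

/-- Each of the `n * (n - 1) / 2` unordered pairs occurs twice, with opposite signs. -/
theorem prod_prod_erase_of_skew {R : Type*} [CommRing R] {n : ℕ} (H : Fin n → Fin n → R)
    (hH : ∀ i j, H j i = -H i j) :
    ∏ j, ∏ k ∈ Finset.univ.erase j, H j k =
      (-1) ^ (n * (n - 1) / 2) * (∏ i, ∏ j ∈ Finset.Ioi i, H i j) ^ 2 := by
  have h := Finset.prod_prod_Ioi_mul_eq_prod_prod_off_diag (fun i j => H j i)
  have h1 : ∀ j : Fin n, Finset.univ.erase j = {j}ᶜ := fun j => by ext; simp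
  simp only [h1]
  rw [← h]
  have h2 : ∀ i j : Fin n, H i j * H j i = (-1) * (H i j) ^ 2 := fun i j => by
    rw [hH i j]; ring
  simp only [h2, Finset.prod_mul_distrib, Finset.prod_const, Finset.prod_pow, Fin.card_Ioi,
    Finset.prod_pow_eq_pow_sum]
  congr 2
  rw [Fin.sum_univ_eq_sum_range (fun i => n - 1 - i), Finset.sum_range_reflect (fun i => i),
    Finset.sum_range_id]

/-- The generalized Cauchy determinant for pairs `(ψ_i, χ_i)`, `(Ψ_j, Χ_j)`. -/
theorem det_cauchy_core {K : Type*} [Field K] {n : ℕ} (f g ψ χ F G Ψ Χ : Fin n → K)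
    (hd : ∀ j k, j ≠ k → F k * G j - F j * G k ≠ 0) :
    (Matrix.of fun i j => (ψ i * Χ j - Ψ j * χ i) *
        ∏ k ∈ Finset.univ.erase j, (F k * g i - f i * G k)).det =
      (-1) ^ (n * (n - 1) / 2) * core n (Fin.append f F) (Fin.append g G) (Fin.append ψ Ψ)
        (Fin.append χ Χ) := by
  classical
  set B : Matrix (Fin n) (Fin n) K := Matrix.of fun i j => (ψ i * Χ j - Ψ j * χ i) *
        ∏ k ∈ Finset.univ.erase j, (F k * g i - f i * G k) with hB
  set M : Matrix (Fin n ⊕ Fin n) (Fin n ⊕ Fin n) K :=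
    hmat n n (Sum.elim f F) (Sum.elim g G) (Sum.elim ψ Ψ) (Sum.elim χ Χ) with hM
  have hcore : core n (Fin.append f F) (Fin.append g G) (Fin.append ψ Ψ) (Fin.append χ Χ) =
      M.det := by
    rw [core, ← Matrix.det_submatrix_equiv_self finSumFinEquiv]
    congr 1
    ext s t
    rcases s with s | s <;>
      simp only [hM, hmat, Matrix.submatrix_apply, id, Equiv.symm_apply_apply, Matrix.of_apply,
        Sum.elim_inl, Sum.elim_inr, finSumFinEquiv_apply_left, finSumFinEquiv_apply_right,
        Fin.append_left, Fin.append_right]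
  rw [hcore]
  -- If some pair `(Ψ j, Χ j)` is zero, both determinants vanish; otherwise it extends to an
  -- invertible 2×2 matrix.
  by_cases h0 : ∃ j, Ψ j = 0 ∧ Χ j = 0
  · obtain ⟨j, hj1, hj2⟩ := h0
    rw [Matrix.det_eq_zero_of_column_eq_zero j fun i => by simp [hB, hj1, hj2],
      Matrix.det_eq_zero_of_row_eq_zero (Sum.inr j) fun t => by
        rcases t with t | t <;> simp [hM, hmat, hj1, hj2], mul_zero]
  push Not at h0
  have hC : ∀ j, ∃ c : Fin n → K, ∀ f g : K, ∏ k ∈ Finset.univ.erase j, (F k * g - f * G k) =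
      ∑ k : Fin n, f ^ (k : ℕ) * g ^ (k.rev : ℕ) * c k := by
    intro j
    obtain ⟨m, rfl⟩ := Nat.exists_eq_succ_of_ne_zero (Nat.pos_iff_ne_zero.mp (Fin.pos j))
    have h := prod_linear_mem_forms (Finset.univ.erase j) F G
    rw [Finset.card_erase_of_mem (Finset.mem_univ j), Finset.card_univ, Fintype.card_fin] at h
    obtain ⟨c, hc⟩ := mem_forms_iff.mp h
    exact ⟨c, fun f g => hc (f, g)⟩
  choose c hc using hC
  let C : Matrix (Fin n) (Fin n) K := Matrix.of fun k j => c j k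
  -- `s j` and `t j` complete `(Χ j, -Ψ j)` to a 2×2 matrix with determinant `Χ j` or `Ψ j`,
  -- whichever is known to be nonzero.
  let s : Fin n → K := fun j => if Ψ j = 0 then 0 else 1
  let t : Fin n → K := fun j => if Ψ j = 0 then 1 else 0
  let δ : Fin n → K := fun j => ∏ k ∈ Finset.univ.erase j, (F k * G j - F j * G k)
  have hδ : ∏ j, δ j ≠ 0 := Finset.prod_ne_zero_iff.mpr fun j _ =>
    Finset.prod_ne_zero_iff.mpr fun k hk => hd j k (Finset.ne_of_mem_erase hk).symm
  have hω : ∏ j, (Χ j * t j - s j * -Ψ j) ≠ 0 := Finset.prod_ne_zero_iff.mpr fun j _ => by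
    by_cases h : Ψ j = 0
    · simp [s, t, h, h0 j h]
    · simp [s, t, h]
  have hYC : Matrix.projVandermonde F G * C = Matrix.diagonal δ := by
    ext i j
    rw [Matrix.mul_apply]
    simp only [Matrix.projVandermonde_apply, C, Matrix.of_apply, ← hc]
    by_cases h : i = j
    · subst h; simp [δ]
    · rw [Matrix.diagonal_apply_ne _ h]
      exact Finset.prod_eq_zero (Finset.mem_erase.mpr ⟨h, Finset.mem_univ i⟩) (by ring)
  -- `C` passes from monomials to the Lagrange products at the points `(F k, G k)`. The second
  -- factor combines the two columns numbered `j` with weights `Χ j, -Ψ j`, so that they cancel in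
  -- the rows of these points.
  let E : Matrix (Fin n ⊕ Fin n) (Fin n ⊕ Fin n) K :=
    Matrix.fromBlocks C 0 0 C * Matrix.fromBlocks (Matrix.diagonal Χ) (Matrix.diagonal s)
      (Matrix.diagonal fun j => -Ψ j) (Matrix.diagonal t)
  have hE : E.det = C.det * C.det * ∏ j, (Χ j * t j - s j * -Ψ j) := by
    rw [Matrix.det_mul, Matrix.det_fromBlocks_zero₂₁, det_fromBlocks_diagonal]
  have hME : M * E = Matrix.fromBlocks B
      (Matrix.of fun i j => (ψ i * s j + χ i * t j) *
        ∏ k ∈ Finset.univ.erase j, (F k * g i - f i * G k)) 0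
      (Matrix.diagonal fun j => δ j * (Χ j * t j - s j * -Ψ j)) := by
    have hM' : M = Matrix.fromBlocks
        (Matrix.diagonal ψ * Matrix.projVandermonde f g)
        (Matrix.diagonal χ * Matrix.projVandermonde f g)
        (Matrix.diagonal Ψ * Matrix.projVandermonde F G)
        (Matrix.diagonal Χ * Matrix.projVandermonde F G) := by
      ext i j
      rcases i with i | i <;> rcases j with j | j <;>
        simp [hM, hmat, Matrix.projVandermonde_apply]
    have hXC : Matrix.projVandermonde f g * C =
        Matrix.of fun i j => ∏ k ∈ Finset.univ.erase j, (F k * g i - f i * G k) := by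
      ext i j
      rw [Matrix.mul_apply]
      simp only [Matrix.projVandermonde_apply, C, Matrix.of_apply, ← hc]
    simp only [E]
    rw [← Matrix.mul_assoc, hM', Matrix.fromBlocks_multiply]
    simp only [Matrix.mul_zero, add_zero, zero_add, Matrix.mul_assoc, hXC, hYC]
    rw [Matrix.fromBlocks_multiply]
    congr 1
    all_goals
      ext i j
      simp [Matrix.mul_diagonal, Matrix.diagonal_mul, hB, Matrix.diagonal_apply]
    · ring
    · ring
    · by_cases h : i = j
      · subst h; simp; ring
      · simp [h]
    · by_cases h : i = j
      · subst h; simp; ring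
      · simp [h]
  have hdet := congrArg Matrix.det hME
  have hYdet := congrArg Matrix.det hYC
  rw [Matrix.det_mul, Matrix.det_diagonal] at hYdet
  rw [Matrix.det_mul, hE, Matrix.det_fromBlocks_zero₂₁, Matrix.det_diagonal,
    Finset.prod_mul_distrib] at hdet
  have hsq : ∏ j, δ j = (-1) ^ (n * (n - 1) / 2) * (Matrix.projVandermonde F G).det ^ 2 := by
    rw [Matrix.det_projVandermonde]
    exact prod_prod_erase_of_skew (fun i j => F j * G i - F i * G j) fun i j => by ring
  have hsign : ((-1 : K) ^ (n * (n - 1) / 2)) * (-1) ^ (n * (n - 1) / 2) = 1 := by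
    rw [← mul_pow, neg_one_mul, neg_neg, one_pow]
  set ε := (-1 : K) ^ (n * (n - 1) / 2)
  set Y := (Matrix.projVandermonde F G).det
  set Δ := ∏ j, δ j
  -- `C.det` is eliminated through `Y * C.det = Δ`, and `Δ = ε * Y ^ 2` then produces the sign.
  have h1 : M.det * (C.det * C.det) = B.det * Δ := mul_right_cancel₀ hω (by linear_combination hdet)
  have h2 : Δ * (M.det * Δ) = Δ * (B.det * Y ^ 2) := by
    rw [← hYdet]
    linear_combination (Y ^ 2) * h1 - B.det * Y^2 * hYdet
  have h3 := mul_left_cancel₀ hδ h2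
  have hY : Y ≠ 0 := fun h => hδ (by rw [← hYdet, h, zero_mul])
  have h4 : Y ^ 2 * (ε * M.det) = Y ^ 2 * B.det := by
    rw [hsq] at h3
    linear_combination h3
  exact (mul_left_cancel₀ (pow_ne_zero 2 hY) h4).symm

/-! ### Expansion of a Pfaffian along its first row -/

/-- The permutation `0 ↦ 0`, `1 ↦ j + 1`, the remaining arguments being permuted as by `τ`. -/
def insertPair {N : ℕ} (j : Fin (N + 1)) (τ : Equiv.Perm (Fin N)) : Equiv.Perm (Fin (N + 2)) :=
  Equiv.Perm.decomposeFin.symm (0, j.cycleRange.symm * Equiv.Perm.decomposeFin.symm (0, τ))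

theorem insertPair_zero {N : ℕ} (j : Fin (N + 1)) (τ : Equiv.Perm (Fin N)) :
    insertPair j τ 0 = 0 := by
  simp [insertPair]

theorem insertPair_succ_zero {N : ℕ} (j : Fin (N + 1)) (τ : Equiv.Perm (Fin N)) :
    insertPair j τ (Fin.succ 0) = j.succ := by
  rw [insertPair, Equiv.Perm.decomposeFin_symm_apply_succ]
  simp

theorem insertPair_succ_succ {N : ℕ} (j : Fin (N + 1)) (τ : Equiv.Perm (Fin N)) (k : Fin N) :
    insertPair j τ k.succ.succ = (j.succAbove (τ k)).succ := by
  rw [insertPair, Equiv.Perm.decomposeFin_symm_apply_succ]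
  simp

theorem sign_insertPair {N : ℕ} (j : Fin (N + 1)) (τ : Equiv.Perm (Fin N)) :
    Equiv.Perm.sign (insertPair j τ) = (-1) ^ (j : ℕ) * Equiv.Perm.sign τ := by
  simp [insertPair, Equiv.Perm.decomposeFin.symm_sign, Fin.sign_cycleRange]

theorem exists_eq_insertPair {N : ℕ} (σ : Equiv.Perm (Fin (N + 2))) (h : σ 0 = 0) :
    ∃ j τ, insertPair j τ = σ := by
  obtain ⟨⟨p, ρ⟩, rfl⟩ := Equiv.Perm.decomposeFin.symm.surjective σ
  rw [Equiv.Perm.decomposeFin_symm_apply_zero] at h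
  subst h
  -- Rotating the value `ρ 0` to the front leaves a permutation fixing `0`, whose action on the rest
  -- is `τ`.
  obtain ⟨⟨r, τ⟩, hτ⟩ := Equiv.Perm.decomposeFin.symm.surjective ((ρ 0).cycleRange * ρ)
  have hr : r = 0 := by
    rw [← Equiv.Perm.decomposeFin_symm_apply_zero r τ, hτ]
    simp
  subst hr
  refine ⟨ρ 0, τ, ?_⟩
  rw [insertPair, hτ]
  congr 2
  ext k
  simp

/-- The relabelling by `Fin.succAbove` is increasing, so it preserves all comparisons among the
remaining values, and each new comparison has `0` as its smaller side. -/
theorem insertPair_mem_matchingPerms {n : ℕ} (j : Fin (2 * n + 1)) (τ : Equiv.Perm (Fin (2 * n))) :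
    (show Equiv.Perm (Fin (2 * (n + 1))) from insertPair j τ) ∈ matchingPerms (n + 1) ↔
      τ ∈ matchingPerms n := by
  simp only [matchingPerms, Finset.mem_filter, Finset.mem_univ, true_and]
  have hss : ∀ (k : ℕ) (hk : k < 2 * n) (h : k + 2 < 2 * n + 2),
      insertPair j τ ⟨k + 2, h⟩ = (j.succAbove (τ ⟨k, hk⟩)).succ := fun k hk h =>
    insertPair_succ_succ j τ ⟨k, hk⟩
  have hlt : ∀ a b : Fin (2 * n), (j.succAbove a).succ < (j.succAbove b).succ ↔ a < b := fun a b => by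
    rw [Fin.succ_lt_succ_iff, (Fin.strictMono_succAbove j).lt_iff_lt]
  constructor
  · rintro ⟨h1, h2⟩
    refine ⟨fun i => ?_, fun i k hik => ?_⟩
    · have hi := i.2
      have h := h1 i.succ
      change insertPair j τ ⟨2 * i + 2, _⟩ < insertPair j τ ⟨(2 * i + 1) + 2, _⟩ at h
      rwa [hss _ (by omega), hss _ (by omega), hlt] at h
    · have hi := i.2
      have hk := k.2
      have h := h2 i.succ k.succ (Fin.succ_lt_succ_iff.mpr hik)
      change insertPair j τ ⟨2 * i + 2, _⟩ < insertPair j τ ⟨2 * k + 2, _⟩ at h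
      rwa [hss _ (by omega), hss _ (by omega), hlt] at h
  · rintro ⟨h1, h2⟩
    refine ⟨fun i => ?_, fun i k hik => ?_⟩
    · refine Fin.cases ?_ (fun i => ?_) i
      · change insertPair j τ 0 < insertPair j τ (Fin.succ 0)
        rw [insertPair_zero, insertPair_succ_zero]
        exact Fin.succ_pos j
      · have hi := i.2
        change insertPair j τ ⟨2 * i + 2, _⟩ < insertPair j τ ⟨(2 * i + 1) + 2, _⟩
        rw [hss _ (by omega), hss _ (by omega), hlt]
        exact h1 i
    · revert hik
      refine Fin.cases ?_ (fun k => ?_) k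
      · intro hik
        exact absurd hik (Fin.not_lt_zero i)
      have hk := k.2
      refine Fin.cases ?_ (fun i => ?_) i
      · intro _
        change insertPair j τ 0 < insertPair j τ ⟨2 * k + 2, _⟩
        rw [hss _ (by omega), insertPair_zero]
        exact Fin.succ_pos _
      · intro hik
        have hi := i.2
        change insertPair j τ ⟨2 * i + 2, _⟩ < insertPair j τ ⟨2 * k + 2, _⟩
        rw [hss _ (by omega), hss _ (by omega), hlt]
        exact h2 i k (Fin.succ_lt_succ_iff.mp hik)

/-- The minimum cannot be taken at an odd position, nor at an even position after the first, because
the matching conditions put a smaller value before it. -/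
theorem apply_zero_of_mem_matchingPerms {n : ℕ} {σ : Equiv.Perm (Fin (2 * (n + 1)))}
    (h : σ ∈ matchingPerms (n + 1)) : σ ⟨0, by omega⟩ = ⟨0, by omega⟩ := by
  simp only [matchingPerms, Finset.mem_filter, Finset.mem_univ, true_and] at h
  obtain ⟨m, hm⟩ := σ.surjective ⟨0, by omega⟩
  have hnot : ∀ a : Fin (2 * (n + 1)), ¬ a < ⟨0, by omega⟩ := fun a ha => Nat.not_lt_zero _ ha
  rcases Nat.even_or_odd' (m : ℕ) with ⟨i, hi | hi⟩
  · have hi' : i < n + 1 := by omega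
    have hmi : m = ⟨2 * i, by omega⟩ := Fin.ext hi
    rcases Nat.eq_zero_or_pos i with h0 | h0
    · subst h0
      rw [hmi] at hm
      exact hm
    · have h2 := h.2 ⟨0, by omega⟩ ⟨i, hi'⟩ h0
      exact absurd (lt_of_lt_of_eq h2 (by rw [← hm, hmi])) (hnot _)
  · have hi' : i < n + 1 := by omega
    have hmi : m = ⟨2 * i + 1, by omega⟩ := Fin.ext hi
    have h1 := h.1 ⟨i, hi'⟩
    exact absurd (lt_of_lt_of_eq h1 (by rw [← hm, hmi])) (hnot _)

/-- The first index. -/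
def pairFst (n : ℕ) : Fin (2 * (n + 1)) := ⟨0, by omega⟩

/-- The `j`-th index after the first. -/
def pairSnd {n : ℕ} (j : Fin (2 * n + 1)) : Fin (2 * (n + 1)) := Fin.succ (n := 2 * n + 1) j

/-- The increasing enumeration of the indices other than `pairFst n` and `pairSnd j`. -/
def pairRest {n : ℕ} (j : Fin (2 * n + 1)) (k : Fin (2 * n)) : Fin (2 * (n + 1)) :=
  pairSnd (j.succAbove k)

/-- Expansion of a Pfaffian along its first row. -/
theorem pfaffian_succ {R : Type*} [CommRing R] {n : ℕ}
    (A : Matrix (Fin (2 * (n + 1))) (Fin (2 * (n + 1))) R) :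
    pfaffian A = ∑ j : Fin (2 * n + 1), (-1) ^ (j : ℕ) * A (pairFst n) (pairSnd j) *
      pfaffian (A.submatrix (pairRest j) (pairRest j)) := by
  rw [pfaffian]
  simp only [pfaffian, Finset.mul_sum]
  rw [Finset.sum_sigma']
  symm
  refine Finset.sum_bij (fun s _ => insertPair s.1 s.2) ?_ ?_ ?_ ?_
  · rintro ⟨j, τ⟩ hs
    rw [Finset.mem_sigma] at hs
    exact (insertPair_mem_matchingPerms j τ).mpr hs.2
  · rintro ⟨j, τ⟩ - ⟨j', τ'⟩ - h
    simp only at h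
    have h1 : j = j' := by
      have := DFunLike.congr_fun h (Fin.succ 0)
      rw [insertPair_succ_zero, insertPair_succ_zero] at this
      exact Fin.succ_injective _ this
    subst h1
    have h2 : τ = τ' := by
      ext k
      have := DFunLike.congr_fun h k.succ.succ
      rw [insertPair_succ_succ, insertPair_succ_succ] at this
      rw [Fin.succAbove_right_injective (Fin.succ_injective _ this)]
    rw [h2]
  · intro σ hσ
    obtain ⟨j, τ, rfl⟩ := exists_eq_insertPair (N := 2 * n) σ (apply_zero_of_mem_matchingPerms hσ)
    exact ⟨⟨j, τ⟩, Finset.mem_sigma.mpr ⟨Finset.mem_univ _,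
      (insertPair_mem_matchingPerms j τ).mp hσ⟩, rfl⟩
  · rintro ⟨j, τ⟩ -
    let σ : Equiv.Perm (Fin (2 * (n + 1))) := insertPair j τ
    have h0 : ∀ h, σ ⟨0, h⟩ = pairFst n := fun _ => insertPair_zero j τ
    have h1 : ∀ h, σ ⟨1, h⟩ = pairSnd j := fun _ => insertPair_succ_zero j τ
    have hss : ∀ (k : ℕ) (hk : k < 2 * n) (h : k + 2 < 2 * n + 2),
        σ ⟨k + 2, h⟩ = pairRest j (τ ⟨k, hk⟩) := fun k hk h =>
      insertPair_succ_succ j τ ⟨k, hk⟩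
    have hsign : Equiv.Perm.sign σ = (-1) ^ (j : ℕ) * Equiv.Perm.sign τ := sign_insertPair j τ
    change _ = ((Equiv.Perm.sign σ : ℤ) : R) *
      ∏ i : Fin (n + 1), A (σ ⟨2 * i, _⟩) (σ ⟨2 * i + 1, _⟩)
    rw [hsign, Fin.prod_univ_succ]
    have hp : ∀ i : Fin n, A (σ ⟨2 * i.succ, by have := i.2; rw [Fin.val_succ]; omega⟩)
        (σ ⟨2 * i.succ + 1, by have := i.2; rw [Fin.val_succ]; omega⟩) =
        A (pairRest j (τ ⟨2 * i, by omega⟩)) (pairRest j (τ ⟨2 * i + 1, by omega⟩)) := by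
      intro i
      rw [← hss _ _ (by omega), ← hss _ _ (by omega)]
      rfl
    simp only [hp]
    have hA : A (σ ⟨2 * (0 : Fin (n + 1)), by simp⟩) (σ ⟨2 * (0 : Fin (n + 1)) + 1, by simp; omega⟩) =
        A (pairFst n) (pairSnd j) := congrArg₂ A (h0 _) (h1 _)
    rw [hA]
    simp only [Matrix.submatrix_apply]
    push_cast
    ring

/-! ### Determinants with two coincident points -/

theorem hmat_map {ι R S : Type*} [CommRing R] [CommRing S] (φ : R →+* S) (p q : ℕ)
    (f g ψ χ : ι → R) : (hmat p q f g ψ χ).map φ =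
      hmat p q (φ ∘ f) (φ ∘ g) (φ ∘ ψ) (φ ∘ χ) := by
  ext i j
  rcases j with j | j <;> simp [hmat]

/-- Taking `A` times a column minus `B` times the next one multiplies row `s` by `A * g s - f s *
B`, which is zero in the two rows at `(A, B)`. These operations scale the determinant by `A ^ (n +
n)`; the remaining corner contributes the same power, and regularity cancels it. -/
theorem det_hmat_two_equal_points_of_isLeftRegular {R : Type*} [CommRing R] {n : ℕ} {A : R}
    (hA : IsLeftRegular A) (B : R) (f g ψ χ : Fin n ⊕ Fin n → R) (ψ' χ' : Fin 1 ⊕ Fin 1 → R) :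
    ((hmat (n + 1) (n + 1) (Sum.elim f fun _ => A) (Sum.elim g fun _ => B) (Sum.elim ψ ψ')
      (Sum.elim χ χ')).submatrix id (blockCols n 1 1)).det =
      (∏ s, (A * g s - f s * B)) * (hmat n n f g ψ χ).det *
        (ψ' (Sum.inl 0) * χ' (Sum.inr 0) - ψ' (Sum.inr 0) * χ' (Sum.inl 0)) := by
  set N := (hmat (n + 1) (n + 1) (Sum.elim f fun _ => A) (Sum.elim g fun _ => B) (Sum.elim ψ ψ')
      (Sum.elim χ χ')).submatrix id (blockCols n 1 1) with hN
  let a : (Fin n ⊕ Fin n) ⊕ (Fin 1 ⊕ Fin 1) → R := Sum.elim f fun _ => A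
  let b : (Fin n ⊕ Fin n) ⊕ (Fin 1 ⊕ Fin 1) → R := Sum.elim g fun _ => B
  let N' : Matrix ((Fin n ⊕ Fin n) ⊕ (Fin 1 ⊕ Fin 1)) ((Fin n ⊕ Fin n) ⊕ (Fin 1 ⊕ Fin 1)) R :=
    Matrix.of fun s => Sum.elim (fun t => (A * b s - a s * B) *
      hmat n n a b (Sum.elim ψ ψ') (Sum.elim χ χ') s t) fun t => N s (Sum.inr t)
  have h1 : N'.det = (∏ t : (Fin n ⊕ Fin n) ⊕ (Fin 1 ⊕ Fin 1),
      Sum.elim (fun _ => A) (fun _ => 1) t) * N.det := by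
    refine det_eq_of_triangular_columns N N' _ (fun t => Sum.elim (fun m : Fin (n + 1) => (m : ℕ))
      (fun m : Fin (n + 1) => (m : ℕ)) (blockCols n 1 1 t)) fun t => ?_
    rcases t with (k | k) | t
    · have hk := k.2
      have h : N'.col (Sum.inl (Sum.inl k)) - A • N.col (Sum.inl (Sum.inl k)) =
          (-B) • N.col ((blockCols n 1 1).symm (Sum.inl k.succ)) := by
        ext s
        simp only [N', N, a, b, hmat, Pi.sub_apply, Pi.smul_apply, Matrix.col_apply,
          Matrix.of_apply, Matrix.submatrix_apply, Equiv.apply_symm_apply, blockCols_inl_inl,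
          Sum.elim_inl, id, smul_eq_mul, Fin.val_castAdd, Fin.val_rev, Fin.val_succ]
        rw [show n + 1 - (k + 1) = n - (k + 1) + 1 by omega,
          show n + 1 - (k + 1 + 1) = n - (k + 1) by omega]
        ring
      simp only [Sum.elim_inl]
      rw [h]
      refine Submodule.smul_mem _ _ (Submodule.subset_span ⟨_, ?_, rfl⟩)
      simp [blockCols_inl_inl]
    · have hk := k.2
      have h : N'.col (Sum.inl (Sum.inr k)) - A • N.col (Sum.inl (Sum.inr k)) =
          (-B) • N.col ((blockCols n 1 1).symm (Sum.inr k.succ)) := by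
        ext s
        simp only [N', N, a, b, hmat, Pi.sub_apply, Pi.smul_apply, Matrix.col_apply,
          Matrix.of_apply, Matrix.submatrix_apply, Equiv.apply_symm_apply, blockCols_inl_inr,
          Sum.elim_inl, Sum.elim_inr, id, smul_eq_mul, Fin.val_castAdd, Fin.val_rev, Fin.val_succ]
        rw [show n + 1 - (k + 1) = n - (k + 1) + 1 by omega,
          show n + 1 - (k + 1 + 1) = n - (k + 1) by omega]
        ring
      simp only [Sum.elim_inl]
      rw [h]
      refine Submodule.smul_mem _ _ (Submodule.subset_span ⟨_, ?_, rfl⟩)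
      simp [blockCols_inl_inr]
    · convert Submodule.zero_mem _
      ext s
      simp [N']
  have h2 : N' = Matrix.fromBlocks
      (Matrix.of fun s t => (A * g s - f s * B) * hmat n n f g ψ χ s t)
      (Matrix.of fun s t => N (Sum.inl s) (Sum.inr t)) 0
      (Matrix.of fun s t => A ^ n * (Matrix.of fun s => Sum.elim (fun _ : Fin 1 => ψ' s)
        (fun _ : Fin 1 => χ' s)) s t) := by
    ext s t
    rcases s with s | s <;> rcases t with t | t
    · rcases t with t | t <;> simp [N', a, b, hmat]
    · simp [N']
    · simp only [N', a, b, Matrix.of_apply, Sum.elim_inr, Sum.elim_inl, sub_self, zero_mul,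
        Matrix.fromBlocks_apply₂₁, Matrix.zero_apply]
    · rcases t with t | t
      · simp only [N', N, hmat, Matrix.of_apply, Sum.elim_inr, Matrix.submatrix_apply, id,
          blockCols_inr_inl, Sum.elim_inl, Matrix.fromBlocks_apply₂₂, Fin.val_natAdd, Fin.val_rev]
        simp [mul_comm]
      · simp only [N', N, hmat, Matrix.of_apply, Sum.elim_inr, Matrix.submatrix_apply, id,
          blockCols_inr_inr, Matrix.fromBlocks_apply₂₂, Fin.val_natAdd, Fin.val_rev]
        simp [mul_comm]
  have h3 : (Matrix.of fun s : Fin 1 ⊕ Fin 1 => Sum.elim (fun _ : Fin 1 => ψ' s)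
        (fun _ : Fin 1 => χ' s)).det =
      ψ' (Sum.inl 0) * χ' (Sum.inr 0) - ψ' (Sum.inr 0) * χ' (Sum.inl 0) := by
    rw [← Matrix.det_submatrix_equiv_self (finSumFinEquiv (m := 1) (n := 1)).symm,
      Matrix.det_fin_two]
    have h0 : (finSumFinEquiv (m := 1) (n := 1)).symm 0 = Sum.inl 0 := rfl
    have h1 : (finSumFinEquiv (m := 1) (n := 1)).symm 1 = Sum.inr 0 := rfl
    simp [h0, h1]
    ring
  rw [h2, Matrix.det_fromBlocks_zero₂₁, Matrix.det_mul_column, Matrix.det_mul_column, h3] at h1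
  have hA' : IsLeftRegular (A ^ (n + n)) := hA.pow _
  refine hA' ?_
  simp only [Fintype.prod_sum_type, Sum.elim_inl, Sum.elim_inr, Finset.prod_const, Finset.card_univ,
    Fintype.card_sum, Fintype.card_fin, one_pow, mul_one] at h1 ⊢
  rw [← h1]
  ring

/-- The determinant of `hmat` when the last two points coincide. -/
theorem det_hmat_two_equal_points {R : Type*} [CommRing R] {n : ℕ} (A B : R)
    (f g ψ χ : Fin n ⊕ Fin n → R) (ψ' χ' : Fin 1 ⊕ Fin 1 → R) :
    ((hmat (n + 1) (n + 1) (Sum.elim f fun _ => A) (Sum.elim g fun _ => B) (Sum.elim ψ ψ')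
      (Sum.elim χ χ')).submatrix id (blockCols n 1 1)).det =
      (∏ s, (A * g s - f s * B)) * (hmat n n f g ψ χ).det *
        (ψ' (Sum.inl 0) * χ' (Sum.inr 0) - ψ' (Sum.inr 0) * χ' (Sum.inl 0)) := by
  -- `A` is replaced by `X + C A`, which is monic and hence regular; then `X` is set to `0`.
  have h := congrArg (Polynomial.evalRingHom (0 : R)) (det_hmat_two_equal_points_of_isLeftRegular
    (Polynomial.monic_X_add_C A).isRegular.left (Polynomial.C B) (Polynomial.C ∘ f)
    (Polynomial.C ∘ g) (Polynomial.C ∘ ψ) (Polynomial.C ∘ χ) (Polynomial.C ∘ ψ') (Polynomial.C ∘ χ'))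
  simp only [map_mul, map_sub, map_prod, RingHom.map_det, RingHom.mapMatrix_apply,
    ← Matrix.submatrix_map, hmat_map] at h
  have h1 : ∀ {ι : Type} (u : ι → R), ⇑(Polynomial.evalRingHom (0 : R)) ∘ (⇑Polynomial.C ∘ u) = u :=
    fun u => by ext; simp
  simp only [Sum.comp_elim, h1] at h
  have h2 : ∀ u : Polynomial R, ⇑(Polynomial.evalRingHom (0 : R)) ∘ (fun _ : Fin 1 ⊕ Fin 1 => u) =
      fun _ => u.eval 0 := fun u => rfl
  simp only [h2] at h
  simpa using h

/-- The columns of `hmat n n`, numbered by `Fin (2 * n)`. -/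
def pairIdx (n : ℕ) : Fin (2 * n) ≃ Fin n ⊕ Fin n :=
  (finCongr (two_mul n)).trans finSumFinEquiv.symm

/-- The determinant of `hmat n n` with rows numbered by `Fin (2 * n)`. -/
def pairDet {R : Type*} [CommRing R] (n : ℕ) (f g ψ χ : Fin (2 * n) → R) : R :=
  ((hmat n n f g ψ χ).submatrix id (pairIdx n)).det

theorem pairDet_eq_det_comp {R : Type*} [CommRing R] (n : ℕ) (f g ψ χ : Fin (2 * n) → R) :
    pairDet n f g ψ χ = (hmat n n (f ∘ (pairIdx n).symm) (g ∘ (pairIdx n).symm)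
      (ψ ∘ (pairIdx n).symm) (χ ∘ (pairIdx n).symm)).det := by
  rw [pairDet, ← Matrix.det_submatrix_equiv_self (pairIdx n).symm]
  congr 1
  ext s t
  rcases t with t | t <;> simp [hmat]

theorem pairSnd_injective {n : ℕ} : Function.Injective (pairSnd (n := n)) := Fin.succ_injective _

theorem pairRest_injective {n : ℕ} (j : Fin (2 * n + 1)) : Function.Injective (pairRest j) :=
  pairSnd_injective.comp Fin.succAbove_right_injective

theorem pairFst_ne_pairSnd {n : ℕ} (j : Fin (2 * n + 1)) : pairFst n ≠ pairSnd j :=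
  (Fin.succ_ne_zero (n := 2 * n + 1) j).symm

theorem pairRest_ne_pairSnd {n : ℕ} (j : Fin (2 * n + 1)) (k : Fin (2 * n)) :
    pairRest j k ≠ pairSnd j := fun h => Fin.succAbove_ne j k (pairSnd_injective h)

/-- All indices, with `pairFst n` and `pairSnd j` put last. -/
def pairLast {n : ℕ} (j : Fin (2 * n + 1)) :
    (Fin n ⊕ Fin n) ⊕ (Fin 1 ⊕ Fin 1) → Fin (2 * (n + 1)) :=
  Sum.elim (fun s => pairRest j ((pairIdx n).symm s))
    (Sum.elim (fun _ => pairFst n) fun _ => pairSnd j)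

theorem pairLast_bijective {n : ℕ} (j : Fin (2 * n + 1)) : Function.Bijective (pairLast j) := by
  rw [Fintype.bijective_iff_injective_and_card]
  constructor
  · rw [pairLast]
    refine Function.Injective.sumElim ((pairRest_injective j).comp (pairIdx n).symm.injective)
      (Function.Injective.sumElim (Function.injective_of_subsingleton _)
        (Function.injective_of_subsingleton _) fun _ _ => pairFst_ne_pairSnd j) ?_
    rintro s (t | t)
    · exact (pairFst_ne_pairSnd _).symm
    · exact pairRest_ne_pairSnd j _
  · simp
    ring

/-- If the point `pairFst n` coincides with the point `pairSnd j`, then `pairDet` factors. -/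
theorem exists_sign_pairDet_two_equal_points (R : Type*) [CommRing R] {n : ℕ}
    (j : Fin (2 * n + 1)) : ∃ ε : R, ε * ε = 1 ∧ ∀ f g ψ χ : Fin (2 * (n + 1)) → R,
      f (pairFst n) = f (pairSnd j) → g (pairFst n) = g (pairSnd j) →
      pairDet (n + 1) f g ψ χ =
        ε * ((∏ k, (f (pairSnd j) * g (pairRest j k) - f (pairRest j k) * g (pairSnd j))) *
          pairDet n (f ∘ pairRest j) (g ∘ pairRest j) (ψ ∘ pairRest j) (χ ∘ pairRest j) *
          (ψ (pairFst n) * χ (pairSnd j) - ψ (pairSnd j) * χ (pairFst n))) := by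
  let r : (Fin n ⊕ Fin n) ⊕ (Fin 1 ⊕ Fin 1) ≃ Fin (2 * (n + 1)) :=
    Equiv.ofBijective _ (pairLast_bijective j)
  let σ := r.symm.trans ((blockCols n 1 1).trans (pairIdx (n + 1)).symm)
  have hs : ((Equiv.Perm.sign σ : ℤ) : R) * ((Equiv.Perm.sign σ : ℤ) : R) = 1 := by
    rw [← Int.cast_mul, ← Units.val_mul, Int.units_mul_self]
    simp
  -- The sign need not be computed: two such determinants are multiplied later, and only `ε * ε = 1`
  -- enters.
  refine ⟨((Equiv.Perm.sign σ : ℤ) : R), hs, fun f g ψ χ hf hg => ?_⟩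
  have h1 := det_submatrix_equiv_equiv ((hmat (n + 1) (n + 1) f g ψ χ).submatrix id (pairIdx (n + 1)))
    r ((blockCols n 1 1).trans (pairIdx (n + 1)).symm)
  have h2 := det_hmat_two_equal_points (f (pairSnd j)) (g (pairSnd j))
    (f ∘ pairRest j ∘ (pairIdx n).symm) (g ∘ pairRest j ∘ (pairIdx n).symm)
    (ψ ∘ pairRest j ∘ (pairIdx n).symm) (χ ∘ pairRest j ∘ (pairIdx n).symm)
    (Sum.elim (fun _ => ψ (pairFst n)) fun _ => ψ (pairSnd j))
    (Sum.elim (fun _ => χ (pairFst n)) fun _ => χ (pairSnd j))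
  have h3 : ((hmat (n + 1) (n + 1) f g ψ χ).submatrix id (pairIdx (n + 1))).submatrix r
      ((blockCols n 1 1).trans (pairIdx (n + 1)).symm) =
      (hmat (n + 1) (n + 1)
        (Sum.elim (f ∘ pairRest j ∘ (pairIdx n).symm) fun _ => f (pairSnd j))
        (Sum.elim (g ∘ pairRest j ∘ (pairIdx n).symm) fun _ => g (pairSnd j))
        (Sum.elim (ψ ∘ pairRest j ∘ (pairIdx n).symm)
          (Sum.elim (fun _ => ψ (pairFst n)) fun _ => ψ (pairSnd j)))
        (Sum.elim (χ ∘ pairRest j ∘ (pairIdx n).symm)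
          (Sum.elim (fun _ => χ (pairFst n)) fun _ => χ (pairSnd j)))).submatrix id
        (blockCols n 1 1) := by
    ext s t
    rcases s with s | s | s <;> rcases h : blockCols n 1 1 t with t' | t' <;>
      simp [r, pairLast, hmat, h, hf, hg]
  rw [h3, h2] at h1
  have h4 : pairDet (n + 1) f g ψ χ = ((Equiv.Perm.sign σ : ℤ) : R) *
      (((Equiv.Perm.sign σ : ℤ) : R) * pairDet (n + 1) f g ψ χ) := by
    rw [← mul_assoc, hs, one_mul]
  rw [h4, pairDet, ← h1, pairDet_eq_det_comp]
  congr 2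
  congr 1
  exact ((pairIdx n).symm.prod_comp fun k =>
    f (pairSnd j) * g (pairRest j k) - f (pairRest j k) * g (pairSnd j))

/-! ### Interpolation and the generalized Schur Pfaffian -/

/-- Lagrange interpolation for binary forms. -/
theorem lagrange_forms {K : Type*} [Field K] {m : ℕ} {Q : K × K → K} (hQ : Q ∈ forms K m)
    (F G : Fin (m + 1) → K) (hd : ∀ j k, j ≠ k → F k * G j - F j * G k ≠ 0) (v : K × K) :
    Q v = ∑ j, Q (F j, G j) * ((∏ l, (F (j.succAbove l) * v.2 - v.1 * G (j.succAbove l))) /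
      ∏ l, (F (j.succAbove l) * G j - F j * G (j.succAbove l))) := by
  let L : Fin (m + 1) → K × K → K := fun j v =>
    ∏ l, (F (j.succAbove l) * v.2 - v.1 * G (j.succAbove l))
  have hL : ∀ j, L j ∈ forms K m := fun j => by
    have h := prod_linear_mem_forms Finset.univ (fun l => F (j.succAbove l))
      fun l => G (j.succAbove l)
    rwa [Finset.card_univ, Fintype.card_fin] at h
  have hL0 : ∀ j, L j (F j, G j) ≠ 0 := fun j =>
    Finset.prod_ne_zero_iff.mpr fun l _ => hd _ _ (Fin.succAbove_ne j l).symm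
  have hL1 : ∀ i j, i ≠ j → L j (F i, G i) = 0 := fun i j hij => by
    obtain ⟨l, rfl⟩ := Fin.exists_succAbove_eq hij
    exact Finset.prod_eq_zero (Finset.mem_univ l) (by simp)
  -- The interpolation error is a form of degree `m` vanishing at `m + 1` pairwise non-proportional
  -- points, so an invertible Vandermonde matrix kills its coefficients.
  let D : K × K → K := Q - ∑ j, (Q (F j, G j) / L j (F j, G j)) • L j
  have hD : D ∈ forms K m := Submodule.sub_mem _ hQ
    (Submodule.sum_mem _ fun j _ => Submodule.smul_mem _ _ (hL j))
  have hD0 : ∀ i, D (F i, G i) = 0 := fun i => by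
    simp only [D, Pi.sub_apply, Finset.sum_apply, Pi.smul_apply, smul_eq_mul]
    rw [Finset.sum_eq_single i (fun j _ hj => by rw [hL1 i j hj.symm, mul_zero]) (by simp),
      div_mul_cancel₀ _ (hL0 i), sub_self]
  obtain ⟨c, hc⟩ := mem_forms_iff.mp hD
  have hc0 : c = 0 := by
    refine Matrix.eq_zero_of_mulVec_eq_zero (M := Matrix.projVandermonde F G) ?_ ?_
    · rw [Matrix.det_projVandermonde]
      exact Finset.prod_ne_zero_iff.mpr fun i _ => Finset.prod_ne_zero_iff.mpr fun j hj =>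
        hd i j (Finset.mem_Ioi.mp hj).ne
    · ext i
      have h := hc (F i, G i)
      rw [hD0] at h
      exact h.symm
  have h := hc v
  simp only [hc0, Pi.zero_apply, mul_zero, Finset.sum_const_zero, D, Pi.sub_apply,
    Finset.sum_apply, Pi.smul_apply, smul_eq_mul] at h
  rw [sub_eq_zero.mp h]
  refine Finset.sum_congr rfl fun j _ => ?_
  rw [div_mul_eq_mul_div, mul_div_assoc]

/-- Only the `j` factors pairing `j` with a smaller index are reversed. -/
theorem prod_Ioi_eq_prod_succAbove {R : Type*} [CommRing R] {N : ℕ}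
    (H : Fin (N + 1) → Fin (N + 1) → R) (hH : ∀ i j, H j i = -H i j) (j : Fin (N + 1)) :
    ∏ i, ∏ k ∈ Finset.Ioi i, H i k = (-1) ^ (j : ℕ) * (∏ l, H j (j.succAbove l)) *
      ∏ i, ∏ k ∈ Finset.Ioi i, H (j.succAbove i) (j.succAbove k) := by
  have h1 : ∀ {M : ℕ} (G : Fin M → Fin M → R) (i : Fin M), ∏ k ∈ Finset.Ioi i, G i k =
      ∏ k, if i < k then G i k else 1 := by
    intro M G i
    rw [← Finset.prod_filter]
    congr 1
    ext k
    simp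
  simp only [h1, h1 fun i k => H (j.succAbove i) (j.succAbove k)]
  rw [Fin.prod_univ_succAbove _ j]
  simp only [Fin.prod_univ_succAbove _ j, lt_irrefl, if_false, one_mul,
    (Fin.strictMono_succAbove j).lt_iff_lt, Finset.prod_mul_distrib]
  rw [← mul_assoc, ← Finset.prod_mul_distrib]
  congr 1
  have h2 : ∀ l : Fin N, ((if j < j.succAbove l then H j (j.succAbove l) else 1) *
      if j.succAbove l < j then H (j.succAbove l) j else 1) =
      (if (l : ℕ) < j then -1 else 1) * H j (j.succAbove l) := by
    intro l
    rcases lt_or_ge (l : ℕ) (j : ℕ) with h | h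
    · have h3 : j.succAbove l < j := (Fin.succAbove_lt_iff_castSucc_lt j l).mpr h
      rw [if_neg h3.not_gt, if_pos h3, if_pos h, hH j]
      ring
    · have h3 : j < j.succAbove l := (Fin.lt_succAbove_iff_le_castSucc j l).mpr h
      rw [if_pos h3, if_neg h3.not_gt, if_neg h.not_gt]
      ring
  simp only [h2, Finset.prod_mul_distrib]
  congr 1
  rw [Fin.prod_univ_eq_prod_range (fun l => if l < (j : ℕ) then (-1 : R) else 1),
    ← Finset.prod_filter, Finset.prod_const]
  congr 1
  have : (Finset.range N).filter (fun l => l < (j : ℕ)) = Finset.range j := by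
    ext l
    have := j.2
    simp only [Finset.mem_filter, Finset.mem_range]
    omega
  rw [this, Finset.card_range]

theorem prod_Ioi_pairs {R : Type*} [CommRing R] {n : ℕ}
    (H : Fin (2 * (n + 1)) → Fin (2 * (n + 1)) → R) (hH : ∀ i j, H j i = -H i j)
    (j : Fin (2 * n + 1)) :
    ∏ i, ∏ k ∈ Finset.Ioi i, H i k = H (pairFst n) (pairSnd j) *
      (∏ l, H (pairFst n) (pairRest j l)) * ((-1) ^ (j : ℕ) * (∏ l, H (pairSnd j) (pairRest j l)) *
      ∏ i, ∏ k ∈ Finset.Ioi i, H (pairRest j i) (pairRest j k)) := by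
  have h := prod_Ioi_eq_prod_succAbove (N := 2 * n + 1) H hH 0
  refine h.trans ?_
  rw [Fin.val_zero, pow_zero, one_mul]
  congr 1
  · exact Fin.prod_univ_succAbove (fun l => H 0 (Fin.succAbove 0 l)) j
  · exact prod_Ioi_eq_prod_succAbove (fun i k => H (Fin.succAbove 0 i) (Fin.succAbove 0 k))
      (fun i k => hH _ _) j

/-- The moving point occurs in one row only, whose entries have degree `n`; the cofactors are
constant. The weights `ψ, χ` of that row stay fixed while the point moves. -/
theorem pairDet_mem_forms {R : Type*} [CommRing R] {n : ℕ} (f g ψ χ : Fin (2 * (n + 1)) → R) :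
    (fun v : R × R => pairDet (n + 1) (Function.update f (pairFst n) v.1)
      (Function.update g (pairFst n) v.2) ψ χ) ∈ forms R n := by
  have h : ∀ v : R × R, pairDet (n + 1) (Function.update f (pairFst n) v.1)
      (Function.update g (pairFst n) v.2) ψ χ =
      ∑ c, (hmat (n + 1) (n + 1) (fun _ : Unit => v.1) (fun _ => v.2) (fun _ => ψ (pairFst n))
        (fun _ => χ (pairFst n))) () (pairIdx (n + 1) c) *
        ((hmat (n + 1) (n + 1) f g ψ χ).submatrix id (pairIdx (n + 1))).adjugate c (pairFst n) := by
    intro v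
    have h1 : (hmat (n + 1) (n + 1) (Function.update f (pairFst n) v.1)
        (Function.update g (pairFst n) v.2) ψ χ).submatrix id (pairIdx (n + 1)) =
        ((hmat (n + 1) (n + 1) f g ψ χ).submatrix id (pairIdx (n + 1))).updateRow (pairFst n)
          (fun c => (hmat (n + 1) (n + 1) (fun _ : Unit => v.1) (fun _ => v.2)
            (fun _ => ψ (pairFst n)) (fun _ => χ (pairFst n))) () (pairIdx (n + 1) c)) := by
      ext i c
      by_cases hi : i = pairFst n
      · subst hi
        rw [Matrix.updateRow_self]
        rcases h : pairIdx (n + 1) c with t | t <;> simp [hmat, h]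
      · rw [Matrix.updateRow_ne hi]
        rcases h : pairIdx (n + 1) c with t | t <;> simp [hmat, h, hi]
    rw [pairDet, h1, ← Matrix.cramer_transpose_apply, Matrix.cramer_eq_adjugate_mulVec,
      ← Matrix.adjugate_transpose, Matrix.mulVec, dotProduct]
    simp only [Matrix.transpose_apply, mul_comm]
  have h2 : (fun v : R × R => pairDet (n + 1) (Function.update f (pairFst n) v.1)
      (Function.update g (pairFst n) v.2) ψ χ) =
      ∑ c, ((hmat (n + 1) (n + 1) f g ψ χ).submatrix id (pairIdx (n + 1))).adjugate c (pairFst n) •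
        fun v : R × R => (hmat (n + 1) (n + 1) (fun _ : Unit => v.1) (fun _ => v.2)
          (fun _ => ψ (pairFst n)) (fun _ => χ (pairFst n))) () (pairIdx (n + 1) c) := by
    ext v
    rw [h]
    simp [mul_comm]
  rw [h2]
  refine Submodule.sum_mem _ fun c _ => Submodule.smul_mem _ _ ?_
  rcases pairIdx (n + 1) c with t | t
  · exact Submodule.smul_mem _ (ψ (pairFst n)) (monomial_mem_forms t)
  · exact Submodule.smul_mem _ (χ (pairFst n)) (monomial_mem_forms t)

/-- The generalized Schur Pfaffian for pairs `(ψ_i, χ_i)` and `(ψ'_i, χ'_i)`. -/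
theorem pfaffian_schur_core {K : Type*} [Field K] : ∀ {n : ℕ} (f g ψ χ ψ' χ' : Fin (2 * n) → K),
    (∀ i j, i ≠ j → f j * g i - f i * g j ≠ 0) →
    pfaffian (Matrix.of fun i j => (ψ i * χ j - ψ j * χ i) * (ψ' i * χ' j - ψ' j * χ' i) /
      (f j * g i - f i * g j)) =
      pairDet n f g ψ χ * pairDet n f g ψ' χ' /
        ∏ i, ∏ j ∈ Finset.Ioi i, (f j * g i - f i * g j) := by
  intro n
  induction n with
  | zero =>
    intro f g ψ χ ψ' χ' _
    have h : matchingPerms 0 = Finset.univ := by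
      ext σ
      simp [matchingPerms]
    rw [pfaffian, h]
    simp [pairDet]
  | succ n ih =>
    intro f g ψ χ ψ' χ' hd
    have hH : ∀ i j : Fin (2 * (n + 1)), f i * g j - f j * g i = -(f j * g i - f i * g j) :=
      fun i j => by ring
    have hall : ∏ i, ∏ j ∈ Finset.Ioi i, (f j * g i - f i * g j) ≠ 0 :=
      Finset.prod_ne_zero_iff.mpr fun i _ => Finset.prod_ne_zero_iff.mpr fun j hj =>
        hd i j (Finset.mem_Ioi.mp hj).ne
    rw [pfaffian_succ, eq_div_iff hall, Finset.sum_mul]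
    -- With denominators cleared, the claim is the interpolation of this form of degree `2 * n` at
    -- the `2 * n + 1` later points, matched term by term with the row expansion.
    let Q : K × K → K := fun v =>
      pairDet (n + 1) (Function.update f (pairFst n) v.1) (Function.update g (pairFst n) v.2) ψ χ *
      pairDet (n + 1) (Function.update f (pairFst n) v.1) (Function.update g (pairFst n) v.2) ψ' χ'
    have hQ : Q ∈ forms K (2 * n) := by
      rw [two_mul]
      exact mul_mem_forms (pairDet_mem_forms f g ψ χ) (pairDet_mem_forms f g ψ' χ')
    have hW := lagrange_forms hQ (f ∘ pairSnd) (g ∘ pairSnd)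
      (fun j k hjk => hd _ _ (pairSnd_injective.ne hjk)) (f (pairFst n), g (pairFst n))
    have hQ0 : Q (f (pairFst n), g (pairFst n)) =
        pairDet (n + 1) f g ψ χ * pairDet (n + 1) f g ψ' χ' := by
      simp only [Q, Function.update_eq_self]
    rw [← hQ0, hW]
    refine Finset.sum_congr rfl fun j _ => ?_
    -- At node `j` the first point coincides with `pairSnd j`, so both determinants factor and leave
    -- those of the remaining `2 * n` points, as in the induction hypothesis.
    obtain ⟨ε, hε, hpair⟩ := exists_sign_pairDet_two_equal_points K j
    have hu : ∀ (u : Fin (2 * (n + 1)) → K) (v : K),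
        Function.update u (pairFst n) v (pairSnd j) = u (pairSnd j) := fun u v =>
      Function.update_of_ne (pairFst_ne_pairSnd j).symm _ _
    have hur : ∀ (u : Fin (2 * (n + 1)) → K) (v : K) k,
        Function.update u (pairFst n) v (pairRest j k) = u (pairRest j k) := fun u v k =>
      Function.update_of_ne (pairFst_ne_pairSnd _).symm _ _
    have hur' : ∀ (u : Fin (2 * (n + 1)) → K) (v : K),
        Function.update u (pairFst n) v ∘ pairRest j = u ∘ pairRest j := fun u v =>
      funext fun k => hur u v k
    have hsq : (∏ k, (f (pairSnd j) * g (pairRest j k) - f (pairRest j k) * g (pairSnd j))) *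
        ∏ k, (f (pairSnd j) * g (pairRest j k) - f (pairRest j k) * g (pairSnd j)) =
        (∏ k, (f (pairRest j k) * g (pairSnd j) - f (pairSnd j) * g (pairRest j k))) *
        ∏ k, (f (pairRest j k) * g (pairSnd j) - f (pairSnd j) * g (pairRest j k)) := by
      rw [← Finset.prod_mul_distrib, ← Finset.prod_mul_distrib]
      exact Finset.prod_congr rfl fun k _ => by ring
    have hQj : Q (f (pairSnd j), g (pairSnd j)) =
        (∏ k, (f (pairRest j k) * g (pairSnd j) - f (pairSnd j) * g (pairRest j k))) ^ 2 *
        (pairDet n (f ∘ pairRest j) (g ∘ pairRest j) (ψ ∘ pairRest j) (χ ∘ pairRest j) *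
          pairDet n (f ∘ pairRest j) (g ∘ pairRest j) (ψ' ∘ pairRest j) (χ' ∘ pairRest j)) *
        ((ψ (pairFst n) * χ (pairSnd j) - ψ (pairSnd j) * χ (pairFst n)) *
          (ψ' (pairFst n) * χ' (pairSnd j) - ψ' (pairSnd j) * χ' (pairFst n))) := by
      simp only [Q]
      rw [hpair _ _ ψ χ (by rw [hu, Function.update_self]) (by rw [hu, Function.update_self]),
        hpair _ _ ψ' χ' (by rw [hu, Function.update_self]) (by rw [hu, Function.update_self])]
      simp only [hu, hur, hur']
      rw [pow_two, ← hsq]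
      linear_combination ((∏ k, (f (pairSnd j) * g (pairRest j k) - f (pairRest j k) * g (pairSnd j))) *
        (∏ k, (f (pairSnd j) * g (pairRest j k) - f (pairRest j k) * g (pairSnd j))) *
        (pairDet n (f ∘ pairRest j) (g ∘ pairRest j) (ψ ∘ pairRest j) (χ ∘ pairRest j) *
          pairDet n (f ∘ pairRest j) (g ∘ pairRest j) (ψ' ∘ pairRest j) (χ' ∘ pairRest j)) *
        ((ψ (pairFst n) * χ (pairSnd j) - ψ (pairSnd j) * χ (pairFst n)) *
          (ψ' (pairFst n) * χ' (pairSnd j) - ψ' (pairSnd j) * χ' (pairFst n)))) * hε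
    have hih := ih (f ∘ pairRest j) (g ∘ pairRest j) (ψ ∘ pairRest j) (χ ∘ pairRest j)
      (ψ' ∘ pairRest j) (χ' ∘ pairRest j) fun i k hik => hd _ _ ((pairRest_injective j).ne hik)
    have hsub : (Matrix.of fun i j => (ψ i * χ j - ψ j * χ i) * (ψ' i * χ' j - ψ' j * χ' i) /
        (f j * g i - f i * g j)).submatrix (pairRest j) (pairRest j) =
        Matrix.of fun i k => ((ψ ∘ pairRest j) i * (χ ∘ pairRest j) k -
          (ψ ∘ pairRest j) k * (χ ∘ pairRest j) i) * ((ψ' ∘ pairRest j) i * (χ' ∘ pairRest j) k -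
          (ψ' ∘ pairRest j) k * (χ' ∘ pairRest j) i) / ((f ∘ pairRest j) k * (g ∘ pairRest j) i -
          (f ∘ pairRest j) i * (g ∘ pairRest j) k) := rfl
    rw [hsub, hih, prod_Ioi_pairs (fun i j => f j * g i - f i * g j) hH j]
    simp only [Function.comp_apply, Matrix.of_apply]
    rw [hQj]
    have e1 : f (pairSnd j) * g (pairFst n) - f (pairFst n) * g (pairSnd j) ≠ 0 :=
      hd _ _ (pairFst_ne_pairSnd j)
    have e2 : ∏ k, (f (pairRest j k) * g (pairSnd j) - f (pairSnd j) * g (pairRest j k)) ≠ 0 :=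
      Finset.prod_ne_zero_iff.mpr fun k _ => hd _ _ (pairRest_ne_pairSnd j k).symm
    have e3 : ∏ i, ∏ k ∈ Finset.Ioi i, (f (pairRest j k) * g (pairRest j i) -
        f (pairRest j i) * g (pairRest j k)) ≠ 0 :=
      Finset.prod_ne_zero_iff.mpr fun i _ => Finset.prod_ne_zero_iff.mpr fun k hk =>
        hd _ _ ((pairRest_injective j).ne (Finset.mem_Ioi.mp hk).ne)
    -- The sign of the row expansion meets the sign of extracting `pairSnd j` from the product of
    -- differences.
    have e4 : ((-1 : K) ^ (j : ℕ)) * (-1) ^ (j : ℕ) = 1 := by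
      rw [← mul_pow, neg_one_mul, neg_neg, one_pow]
    change _ = _ * ((∏ l, (f (pairRest j l) * g (pairFst n) - f (pairFst n) * g (pairRest j l))) /
      ∏ l, (f (pairRest j l) * g (pairSnd j) - f (pairSnd j) * g (pairRest j l)))
    generalize (∏ k, (f (pairRest j k) * g (pairSnd j) - f (pairSnd j) * g (pairRest j k))) = Pj at *
    generalize (∏ l, (f (pairRest j l) * g (pairFst n) - f (pairFst n) * g (pairRest j l))) = Po at *
    generalize (∏ i, ∏ k ∈ Finset.Ioi i, (f (pairRest j k) * g (pairRest j i) -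
        f (pairRest j i) * g (pairRest j k))) = Pr at *
    generalize f (pairSnd j) * g (pairFst n) - f (pairFst n) * g (pairSnd j) = h0 at *
    generalize ((-1 : K) ^ (j : ℕ)) = s at *
    field_simp
    linear_combination ((ψ (pairFst n) * χ (pairSnd j) - ψ (pairSnd j) * χ (pairFst n)) *
      (ψ' (pairFst n) * χ' (pairSnd j) - ψ' (pairSnd j) * χ' (pairFst n)) *
      pairDet n (f ∘ pairRest j) (g ∘ pairRest j) (ψ ∘ pairRest j) (χ ∘ pairRest j) *
      pairDet n (f ∘ pairRest j) (g ∘ pairRest j) (ψ' ∘ pairRest j) (χ' ∘ pairRest j) * Po) * e4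

/-! ### The Cauchy-type identity, by specialization from independent variables -/

theorem F_map {R S : Type*} [CommRing R] [CommRing S] (φ : R →+* S) (p q : ℕ)
    (x a : Fin (p + q) → R) : φ (F p q x a) = F p q (φ ∘ x) (φ ∘ a) := by
  simp only [F, map_sum, map_mul, map_pow, map_neg, map_one, RingHom.map_det]
  refine Finset.sum_congr rfl fun lam _ => Finset.sum_congr rfl fun mu _ => ?_
  congr 2
  ext i j
  refine Fin.addCases (fun j => ?_) (fun j => ?_) j <;> simp [V]

theorem F_cast {R : Type*} [CommRing R] {p p' q q' : ℕ} (hp : p' = p) (hq : q' = q)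
    (x a : Fin (p + q) → R) :
    F p q x a = F p' q' (x ∘ Fin.cast (by omega)) (a ∘ Fin.cast (by omega)) := by
  subst hp hq
  rfl

theorem comp_append {α β : Type*} {m n : ℕ} (φ : α → β) (u : Fin m → α) (v : Fin n → α) :
    φ ∘ Fin.append u v = Fin.append (φ ∘ u) (φ ∘ v) := by
  ext i
  refine Fin.addCases (fun i => ?_) (fun i => ?_) i <;> simp

theorem append_comp_cast {α : Type*} {m m' k N : ℕ} (h : m' = m) (h₁ : N = m + k)
    (h₂ : N = m' + k) (u : Fin m → α) (v : Fin k → α) :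
    Fin.append u v ∘ Fin.cast h₁ = Fin.append (u ∘ Fin.cast h) v ∘ Fin.cast h₂ := by
  subst h h₁
  rfl

theorem succ_add_succ_eq (p q : ℕ) : p + 1 + (q + 1) = 2 + (p + q) := by
  ring

theorem add_add_add_eq_two_mul (n p q : ℕ) : n + p + (n + q) = 2 * n + (p + q) := by
  ring

/-- `F^{p+1,q+1}` with two distinguished points. -/
noncomputable def F₂ {R : Type*} [CommRing R] (p q : ℕ) (x y a b : R) (z c : Fin (p + q) → R) : R :=
  F (p + 1) (q + 1) (Fin.append ![x, y] z ∘ Fin.cast (succ_add_succ_eq p q))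
    (Fin.append ![a, b] c ∘ Fin.cast (succ_add_succ_eq p q))

theorem F₂_map {R S : Type*} [CommRing R] [CommRing S] (φ : R →+* S) {p q : ℕ} (x y a b : R)
    (z c : Fin (p + q) → R) :
    φ (F₂ p q x y a b z c) = F₂ p q (φ x) (φ y) (φ a) (φ b) (φ ∘ z) (φ ∘ c) := by
  have h : ∀ x y : R, φ ∘ ![x, y] = ![φ x, φ y] := fun x y => by
    ext i; fin_cases i <;> rfl
  simp only [F₂, F_map, ← Function.comp_assoc, comp_append, h]

/-- Here `κ = (-1)^p (∏ k, z k) F p q z c`. In `exists_F_append_eq` the factor `F p q z c` occurs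
only once for each `n`, so `n - 1` further copies are needed to complete `κ ^ n`. -/
theorem exists_F_eq_core {K : Type*} [Field K] {p q : ℕ} {z c : Fin (p + q) → K}
    (hD : F p q z c ≠ 0) (hz : ∀ k, z k ≠ 0) :
    ∃ (κ : K) (φ₁ φ₂ : K → K → K),
      (∀ x y a b, F₂ p q x y a b z c = κ * (φ₁ x a * φ₂ y b - φ₁ y b * φ₂ x a)) ∧
      ∀ n, 0 < n → ∀ (x a : Fin (n + n) → K),
        F p q z c ^ (n - 1) * F (n + p) (n + q) (Fin.append x z ∘ Fin.cast (Nat.add_add_add_comm n p n q))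
          (Fin.append a c ∘ Fin.cast (Nat.add_add_add_comm n p n q)) =
        κ ^ n * core n x (fun i => 1 + x i ^ 2) (fun i => φ₁ (x i) (a i))
          (fun i => φ₂ (x i) (a i)) := by
  obtain ⟨φ₁, φ₂, h⟩ := exists_F_append_eq hD hz
  refine ⟨(-1) ^ p * ((∏ k, z k) * F p q z c), φ₁, φ₂, fun x y a b => ?_, fun n hn x a => ?_⟩
  · have h1 := h 1 ![x, y] ![a, b]
    rw [core_one, one_mul, pow_one] at h1
    simp only [Matrix.cons_val_zero, Matrix.cons_val_one] at h1
    rw [F₂, F_cast (add_comm 1 p) (add_comm 1 q)]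
    refine h1.trans ?_
    ring
  · obtain ⟨m, rfl⟩ : ∃ m, n = m + 1 := ⟨n - 1, by omega⟩
    rw [h (m + 1) x a, Nat.add_sub_cancel, mul_pow, mul_pow, ← pow_mul, mul_comm p]
    ring

theorem cauchy_cleared_of_ne_zero {K : Type*} [Field K] {n p q : ℕ} (hn : 0 < n)
    (x y a b : Fin n → K) {z c : Fin (p + q) → K} (hD : F p q z c ≠ 0) (hz : ∀ k, z k ≠ 0)
    (hd : ∀ j k, j ≠ k → (y k - y j) * (1 - y j * y k) ≠ 0) :
    (Matrix.of fun i j => F₂ p q (x i) (y j) (a i) (b j) z c *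
      ∏ k ∈ Finset.univ.erase j, ((y k - x i) * (1 - x i * y k))).det =
      (-1) ^ (n * (n - 1) / 2) * (F p q z c ^ (n - 1) *
        F (n + p) (n + q) (Fin.append (Fin.append x y) z ∘ Fin.cast (Nat.add_add_add_comm n p n q))
          (Fin.append (Fin.append a b) c ∘ Fin.cast (Nat.add_add_add_comm n p n q))) := by
  obtain ⟨κ, φ₁, φ₂, h₂, hn'⟩ := exists_F_eq_core hD hz
  have hfac : ∀ u v : K, (v - u) * (1 - u * v) = v * (1 + u ^ 2) - u * (1 + v ^ 2) :=
    fun u v => by ring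
  have hcore := det_cauchy_core x (fun i => 1 + x i ^ 2) (fun i => φ₁ (x i) (a i))
    (fun i => φ₂ (x i) (a i)) y (fun i => 1 + y i ^ 2) (fun i => φ₁ (y i) (b i))
    (fun i => φ₂ (y i) (b i)) fun j k hjk => by rw [← hfac]; exact hd j k hjk
  have happ : ∀ φ : K → K → K, Fin.append (fun i => φ (x i) (a i)) (fun i => φ (y i) (b i)) =
      fun i => φ (Fin.append x y i) (Fin.append a b i) := fun φ => by
    ext i
    refine Fin.addCases (fun i => ?_) (fun i => ?_) i <;>
      simp only [Fin.append_left, Fin.append_right]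
  rw [happ φ₁, happ φ₂, happ fun u _ => 1 + u ^ 2] at hcore
  rw [hn' n hn, mul_left_comm, ← hcore]
  have hM : (Matrix.of fun i j => F₂ p q (x i) (y j) (a i) (b j) z c *
      ∏ k ∈ Finset.univ.erase j, ((y k - x i) * (1 - x i * y k))) =
      κ • Matrix.of fun i j => (φ₁ (x i) (a i) * φ₂ (y j) (b j) - φ₁ (y j) (b j) * φ₂ (x i) (a i)) *
        ∏ k ∈ Finset.univ.erase j, (y k * (1 + x i ^ 2) - x i * (1 + y k ^ 2)) := by
    ext i j
    simp only [Matrix.of_apply, Matrix.smul_apply, smul_eq_mul, h₂, hfac]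
    ring
  rw [hM, Matrix.det_smul, Fintype.card_fin]

theorem one_sub_X_mul_X_ne_zero {σ K : Type*} [Field K] (s t : σ) :
    (1 - MvPolynomial.X s * MvPolynomial.X t : MvPolynomial σ K) ≠ 0 := fun h => by
  have := congrArg (MvPolynomial.constantCoeff (R := K)) h
  simp at this

/-- Setting the second family of variables to `0` on the first `p` indices and to `1` on the last
`q` makes the matrix block triangular with two Vandermonde blocks at distinct points `(X, 1 + X^2)`.
-/
theorem F_X_ne_zero {σ K : Type*} [Field K] {p q : ℕ} {ι₁ ι₂ : Fin (p + q) → σ}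
    (h₁ : Function.Injective ι₁) (h₂ : Function.Injective ι₂) (h₁₂ : ∀ i j, ι₂ i ≠ ι₁ j) :
    F p q (fun k => (MvPolynomial.X (ι₁ k) : MvPolynomial σ K))
      (fun k => MvPolynomial.X (ι₂ k)) ≠ 0 := by
  intro h0
  let e : σ → MvPolynomial σ K := Function.extend ι₂ (Fin.append 0 1) MvPolynomial.X
  have h := congrArg (MvPolynomial.eval₂Hom MvPolynomial.C e) h0
  have e1 : (MvPolynomial.eval₂Hom MvPolynomial.C e) ∘ (fun k => MvPolynomial.X (ι₁ k)) =
      fun k => (MvPolynomial.X (ι₁ k) : MvPolynomial σ K) := by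
    ext1 k
    simp only [Function.comp_apply, MvPolynomial.eval₂Hom_X', e]
    rw [Function.extend_apply']
    rintro ⟨i, hi⟩
    exact h₁₂ i k hi
  have e2 : (MvPolynomial.eval₂Hom MvPolynomial.C e) ∘ (fun k => MvPolynomial.X (ι₂ k)) =
      (Fin.append 0 1 : Fin (p + q) → MvPolynomial σ K) := by
    ext1 k
    simp only [Function.comp_apply, MvPolynomial.eval₂Hom_X', e]
    rw [h₂.extend_apply]
  rw [F_map, e1, e2, map_zero, F_eq_det_hrow] at h
  have hblock : (Matrix.of fun s : Fin p ⊕ Fin q =>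
      hrow p q (MvPolynomial.X (ι₁ (finSumFinEquiv s)) : MvPolynomial σ K)
        (Fin.append 0 1 (finSumFinEquiv s))) = Matrix.fromBlocks
      (Matrix.projVandermonde (fun k => MvPolynomial.X (ι₁ (Fin.castAdd q k)))
        fun k => 1 + MvPolynomial.X (ι₁ (Fin.castAdd q k)) ^ 2) 0
      (Matrix.of fun s t => hrow p q (MvPolynomial.X (ι₁ (Fin.natAdd p s))) 1 (Sum.inl t))
      (Matrix.projVandermonde (fun k => MvPolynomial.X (ι₁ (Fin.natAdd p k)))
        fun k => 1 + MvPolynomial.X (ι₁ (Fin.natAdd p k)) ^ 2) := by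
    ext1 s t
    rcases s with s | s <;> rcases t with t | t <;> simp [hrow, Matrix.projVandermonde_apply]
  rw [hblock, Matrix.det_fromBlocks_zero₁₂, mul_eq_zero, Matrix.det_projVandermonde,
    Matrix.det_projVandermonde] at h
  have hne : ∀ {m : ℕ} (u : Fin m → Fin (p + q)), Function.Injective u →
      ∏ i, ∏ j ∈ Finset.Ioi i, ((MvPolynomial.X (ι₁ (u j)) : MvPolynomial σ K) *
        (1 + MvPolynomial.X (ι₁ (u i)) ^ 2) - MvPolynomial.X (ι₁ (u i)) *
        (1 + MvPolynomial.X (ι₁ (u j)) ^ 2)) ≠ 0 := by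
    intro m u hu
    refine Finset.prod_ne_zero_iff.mpr fun i _ => Finset.prod_ne_zero_iff.mpr fun j hj => ?_
    have hij : MvPolynomial.X (ι₁ (u j)) ≠ (MvPolynomial.X (ι₁ (u i)) : MvPolynomial σ K) :=
      (MvPolynomial.X_injective.comp (h₁.comp hu)).ne (Finset.mem_Ioi.mp hj).ne'
    have hfac : (MvPolynomial.X (ι₁ (u j)) : MvPolynomial σ K) *
        (1 + MvPolynomial.X (ι₁ (u i)) ^ 2) - MvPolynomial.X (ι₁ (u i)) *
        (1 + MvPolynomial.X (ι₁ (u j)) ^ 2) = (MvPolynomial.X (ι₁ (u j)) - MvPolynomial.X (ι₁ (u i))) *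
          (1 - MvPolynomial.X (ι₁ (u i)) * MvPolynomial.X (ι₁ (u j))) := by ring
    rw [hfac]
    exact mul_ne_zero (sub_ne_zero.mpr hij) (one_sub_X_mul_X_ne_zero _ _)
  rcases h with h | h
  · exact hne _ (Fin.castAdd_injective p q) h
  · exact hne _ (Fin.natAdd_injective q p) h

/-- The left side of the Cauchy-type identity with denominators cleared. -/
noncomputable def cauchyDet {R : Type*} [CommRing R] {n p q : ℕ} (x y a b : Fin n → R)
    (z c : Fin (p + q) → R) : R :=
  (Matrix.of fun i j => F₂ p q (x i) (y j) (a i) (b j) z c *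
    ∏ k ∈ Finset.univ.erase j, ((y k - x i) * (1 - x i * y k))).det

theorem cauchyDet_map {R S : Type*} [CommRing R] [CommRing S] (φ : R →+* S) {n p q : ℕ}
    (x y a b : Fin n → R) (z c : Fin (p + q) → R) : φ (cauchyDet x y a b z c) =
      cauchyDet (φ ∘ x) (φ ∘ y) (φ ∘ a) (φ ∘ b) (φ ∘ z) (φ ∘ c) := by
  rw [cauchyDet, cauchyDet, RingHom.map_det]
  congr 1
  ext i j
  simp [F₂_map]

/-- The right side of the Cauchy-type identity with denominators cleared. -/
noncomputable def cauchyProd {R : Type*} [CommRing R] {n p q : ℕ} (x y a b : Fin n → R)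
    (z c : Fin (p + q) → R) : R :=
  (-1) ^ (n * (n - 1) / 2) * (F p q z c ^ (n - 1) *
    F (n + p) (n + q) (Fin.append (Fin.append x y) z ∘ Fin.cast (Nat.add_add_add_comm n p n q))
      (Fin.append (Fin.append a b) c ∘ Fin.cast (Nat.add_add_add_comm n p n q)))

theorem cauchyProd_map {R S : Type*} [CommRing R] [CommRing S] (φ : R →+* S) {n p q : ℕ}
    (x y a b : Fin n → R) (z c : Fin (p + q) → R) : φ (cauchyProd x y a b z c) =
      cauchyProd (φ ∘ x) (φ ∘ y) (φ ∘ a) (φ ∘ b) (φ ∘ z) (φ ∘ c) := by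
  simp only [cauchyProd, map_mul, map_pow, map_neg, map_one, F_map, ← Function.comp_assoc,
    comp_append]

/-- Both sides are polynomial, so `y, z, c` may be taken as independent variables and evaluated
afterwards. The nonvanishing conditions do not involve `x, a, b`, which stay constant. -/
theorem cauchyDet_eq_cauchyProd {K : Type*} [Field K] {n p q : ℕ} (hn : 0 < n)
    (x y a b : Fin n → K) (z c : Fin (p + q) → K) :
    cauchyDet x y a b z c = cauchyProd x y a b z c := by
  let σ := Fin n ⊕ Fin (p + q) ⊕ Fin (p + q)
  let R := MvPolynomial σ K
  let φ : R →+* FractionRing R := algebraMap R (FractionRing R)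
  have hφ : Function.Injective φ := IsFractionRing.injective R (FractionRing R)
  let ev : R →+* K := MvPolynomial.eval (Sum.elim y (Sum.elim z c))
  let Y : Fin n → R := fun k => MvPolynomial.X (Sum.inl k)
  let Z : Fin (p + q) → R := fun k => MvPolynomial.X (Sum.inr (Sum.inl k))
  let C : Fin (p + q) → R := fun k => MvPolynomial.X (Sum.inr (Sum.inr k))
  have hgen : cauchyDet (MvPolynomial.C ∘ x) Y (MvPolynomial.C ∘ a) (MvPolynomial.C ∘ b) Z C =
      cauchyProd (MvPolynomial.C ∘ x) Y (MvPolynomial.C ∘ a) (MvPolynomial.C ∘ b) Z C := by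
    apply hφ
    rw [cauchyDet_map, cauchyProd_map]
    refine cauchy_cleared_of_ne_zero hn _ _ _ _ ?_ (fun k => ?_) fun j k hjk => ?_
    · rw [← F_map, map_ne_zero_iff φ hφ]
      refine F_X_ne_zero (ι₁ := fun k => Sum.inr (Sum.inl k)) (ι₂ := fun k => Sum.inr (Sum.inr k))
        ?_ ?_ ?_
      · exact Sum.inr_injective.comp Sum.inl_injective
      · exact Sum.inr_injective.comp Sum.inr_injective
      · simp
    · exact (map_ne_zero_iff φ hφ).mpr (MvPolynomial.X_ne_zero _)
    · have h : (Y k - Y j) * (1 - Y j * Y k) ≠ 0 :=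
        mul_ne_zero (sub_ne_zero.mpr ((MvPolynomial.X_injective.comp Sum.inl_injective).ne hjk.symm))
          (one_sub_X_mul_X_ne_zero _ _)
      simpa using (map_ne_zero_iff φ hφ).mpr h
  have h := congrArg ev hgen
  rw [cauchyDet_map, cauchyProd_map] at h
  have hC : ∀ u : Fin n → K, ev ∘ (MvPolynomial.C ∘ u) = u := fun u => funext fun k => MvPolynomial.eval_C _
  have hY : ev ∘ Y = y := funext fun k => (MvPolynomial.eval_X _).trans rfl
  have hZ : ev ∘ Z = z := funext fun k => (MvPolynomial.eval_X _).trans rfl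
  have hC' : ev ∘ C = c := funext fun k => (MvPolynomial.eval_X _).trans rfl
  rwa [hC, hC, hC, hY, hZ, hC'] at h

/-! ### The Schur-type identity -/

theorem pfaffian_map {R S : Type*} [CommRing R] [CommRing S] (φ : R →+* S) {n : ℕ}
    (A : Matrix (Fin (2 * n)) (Fin (2 * n)) R) : φ (pfaffian A) = pfaffian (A.map φ) := by
  simp [pfaffian]

theorem pfaffian_smul {R : Type*} [CommRing R] {n : ℕ} (κ : R)
    (A : Matrix (Fin (2 * n)) (Fin (2 * n)) R) : pfaffian (κ • A) = κ ^ n * pfaffian A := by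
  simp only [pfaffian, Matrix.smul_apply, smul_eq_mul, Finset.prod_mul_distrib, Finset.prod_const,
    Finset.card_univ, Fintype.card_fin, Finset.mul_sum]
  exact Finset.sum_congr rfl fun σ _ => by ring

theorem core_comp_cast {R : Type*} [CommRing R] (n : ℕ) (f g ψ χ : Fin (2 * n) → R) :
    core n (f ∘ Fin.cast (two_mul n).symm) (g ∘ Fin.cast (two_mul n).symm)
      (ψ ∘ Fin.cast (two_mul n).symm) (χ ∘ Fin.cast (two_mul n).symm) = pairDet n f g ψ χ := by
  rw [core, ← Matrix.det_submatrix_equiv_self (finCongr (two_mul n)), pairDet]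
  congr 1

/-- The Pfaffian of the Schur-type identity, with weights `e` in place of the denominators. -/
noncomputable def schurPf {R : Type*} [CommRing R] {n p q r s : ℕ} (x a b : Fin (2 * n) → R)
    (z c : Fin (p + q) → R) (w d : Fin (r + s) → R) (e : Fin (2 * n) → Fin (2 * n) → R) : R :=
  pfaffian (Matrix.of fun i j => F₂ p q (x i) (x j) (a i) (a j) z c *
    F₂ r s (x i) (x j) (b i) (b j) w d * e i j)

theorem schurPf_map {R S : Type*} [CommRing R] [CommRing S] (φ : R →+* S) {n p q r s : ℕ}
    (x a b : Fin (2 * n) → R) (z c : Fin (p + q) → R) (w d : Fin (r + s) → R)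
    (e : Fin (2 * n) → Fin (2 * n) → R) : φ (schurPf x a b z c w d e) =
      schurPf (φ ∘ x) (φ ∘ a) (φ ∘ b) (φ ∘ z) (φ ∘ c) (φ ∘ w) (φ ∘ d) fun i j => φ (e i j) := by
  rw [schurPf, schurPf, pfaffian_map]
  congr 1
  ext i j
  simp [F₂_map]

/-- The right side of the Schur-type identity without the denominators. -/
noncomputable def schurProd {R : Type*} [CommRing R] {n p q r s : ℕ} (x a b : Fin (2 * n) → R)
    (z c : Fin (p + q) → R) (w d : Fin (r + s) → R) : R :=
  F p q z c ^ (n - 1) * F r s w d ^ (n - 1) *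
    F (n + p) (n + q) (Fin.append x z ∘ Fin.cast (add_add_add_eq_two_mul n p q))
      (Fin.append a c ∘ Fin.cast (add_add_add_eq_two_mul n p q)) *
    F (n + r) (n + s) (Fin.append x w ∘ Fin.cast (add_add_add_eq_two_mul n r s))
      (Fin.append b d ∘ Fin.cast (add_add_add_eq_two_mul n r s))

theorem schurProd_map {R S : Type*} [CommRing R] [CommRing S] (φ : R →+* S) {n p q r s : ℕ}
    (x a b : Fin (2 * n) → R) (z c : Fin (p + q) → R) (w d : Fin (r + s) → R) :
    φ (schurProd x a b z c w d) =
      schurProd (φ ∘ x) (φ ∘ a) (φ ∘ b) (φ ∘ z) (φ ∘ c) (φ ∘ w) (φ ∘ d) := by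
  simp only [schurProd, map_mul, map_pow, F_map, ← Function.comp_assoc, comp_append]

/-- The two factors `F` have their own parameters and hence their own `φ₁, φ₂`, but share the points
`(x, 1 + x^2)`, which is the setting of `pfaffian_schur_core`. -/
theorem schur_of_ne_zero {K : Type*} [Field K] {n p q r s : ℕ} (hn : 0 < n)
    (x a b : Fin (2 * n) → K) {z c : Fin (p + q) → K} {w d : Fin (r + s) → K}
    (hD : F p q z c ≠ 0) (hz : ∀ k, z k ≠ 0) (hD' : F r s w d ≠ 0) (hw : ∀ k, w k ≠ 0)
    (hx : ∀ i j, i < j → (x j - x i) * (1 - x i * x j) ≠ 0) :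
    schurPf x a b z c w d (fun i j => ((x j - x i) * (1 - x i * x j))⁻¹) =
      (∏ i, ∏ j ∈ Finset.Ioi i, (x j - x i) * (1 - x i * x j))⁻¹ * schurProd x a b z c w d := by
  obtain ⟨κ, φ₁, φ₂, h₂, hn₁⟩ := exists_F_eq_core hD hz
  obtain ⟨κ', φ₁', φ₂', h₂', hn₂⟩ := exists_F_eq_core hD' hw
  have hfac : ∀ u v : K, (v - u) * (1 - u * v) = v * (1 + u ^ 2) - u * (1 + v ^ 2) :=
    fun u v => by ring
  have hP := pfaffian_schur_core x (fun i => 1 + x i ^ 2) (fun i => φ₁ (x i) (a i))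
    (fun i => φ₂ (x i) (a i)) (fun i => φ₁' (x i) (b i)) (fun i => φ₂' (x i) (b i))
    fun i j hij => by
      rw [← hfac]
      rcases lt_or_gt_of_ne hij with h | h
      · exact hx i j h
      · have := hx j i h
        -- Swapping the two indices only changes the sign of the factor.
        rw [← neg_ne_zero]
        convert this using 1
        ring
  simp only [← hfac] at hP
  have hM : (Matrix.of fun i j => F₂ p q (x i) (x j) (a i) (a j) z c *
      F₂ r s (x i) (x j) (b i) (b j) w d * ((x j - x i) * (1 - x i * x j))⁻¹) =
      (κ * κ') • Matrix.of fun i j =>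
        (φ₁ (x i) (a i) * φ₂ (x j) (a j) - φ₁ (x j) (a j) * φ₂ (x i) (a i)) *
        (φ₁' (x i) (b i) * φ₂' (x j) (b j) - φ₁' (x j) (b j) * φ₂' (x i) (b i)) /
        ((x j - x i) * (1 - x i * x j)) := by
    ext i j
    simp only [Matrix.of_apply, Matrix.smul_apply, smul_eq_mul, h₂, h₂', div_eq_mul_inv]
    ring
  have e₁ := hn₁ n hn (x ∘ Fin.cast (two_mul n).symm) (a ∘ Fin.cast (two_mul n).symm)
  have e₂ := hn₂ n hn (x ∘ Fin.cast (two_mul n).symm) (b ∘ Fin.cast (two_mul n).symm)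
  rw [← append_comp_cast _ (add_add_add_eq_two_mul n p q),
    ← append_comp_cast _ (add_add_add_eq_two_mul n p q)] at e₁
  rw [← append_comp_cast _ (add_add_add_eq_two_mul n r s),
    ← append_comp_cast _ (add_add_add_eq_two_mul n r s)] at e₂
  have c₁ := core_comp_cast n x (fun i => 1 + x i ^ 2) (fun i => φ₁ (x i) (a i))
    (fun i => φ₂ (x i) (a i))
  have c₂ := core_comp_cast n x (fun i => 1 + x i ^ 2) (fun i => φ₁' (x i) (b i))
    (fun i => φ₂' (x i) (b i))
  replace e₁ := e₁.trans (congrArg (κ ^ n * ·) c₁)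
  replace e₂ := e₂.trans (congrArg (κ' ^ n * ·) c₂)
  rw [schurPf, hM, pfaffian_smul, hP, schurProd, mul_pow]
  rw [div_eq_mul_inv]
  set I := (∏ i, ∏ j ∈ Finset.Ioi i, (x j - x i) * (1 - x i * x j))⁻¹
  linear_combination (-I * κ' ^ n * pairDet n x (fun i => 1 + x i ^ 2) (fun i => φ₁' (x i) (b i))
    (fun i => φ₂' (x i) (b i))) * e₁ - I * (F p q z c ^ (n - 1) *
      F (n + p) (n + q) (Fin.append x z ∘ Fin.cast (add_add_add_eq_two_mul n p q))
      (Fin.append a c ∘ Fin.cast (add_add_add_eq_two_mul n p q))) * e₂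

/-- The inverses of the denominators already lie in `K` and act as constants, so only `z, c, w, d`
are made independent variables. -/
theorem schurPf_eq_schurProd {K : Type*} [Field K] {n p q r s : ℕ} (hn : 0 < n)
    (x a b : Fin (2 * n) → K) (z c : Fin (p + q) → K) (w d : Fin (r + s) → K)
    (hx : ∀ i j, i < j → (x j - x i) * (1 - x i * x j) ≠ 0) :
    schurPf x a b z c w d (fun i j => ((x j - x i) * (1 - x i * x j))⁻¹) =
      (∏ i, ∏ j ∈ Finset.Ioi i, (x j - x i) * (1 - x i * x j))⁻¹ * schurProd x a b z c w d := by
  let σ := (Fin (p + q) ⊕ Fin (p + q)) ⊕ (Fin (r + s) ⊕ Fin (r + s))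
  let R := MvPolynomial σ K
  let φ : R →+* FractionRing R := algebraMap R (FractionRing R)
  have hφ : Function.Injective φ := IsFractionRing.injective R (FractionRing R)
  let ev : R →+* K := MvPolynomial.eval (Sum.elim (Sum.elim z c) (Sum.elim w d))
  let Z : Fin (p + q) → R := fun k => MvPolynomial.X (Sum.inl (Sum.inl k))
  let C : Fin (p + q) → R := fun k => MvPolynomial.X (Sum.inl (Sum.inr k))
  let W : Fin (r + s) → R := fun k => MvPolynomial.X (Sum.inr (Sum.inl k))
  let D : Fin (r + s) → R := fun k => MvPolynomial.X (Sum.inr (Sum.inr k))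
  let θ : K →+* FractionRing R := φ.comp MvPolynomial.C
  have hθ : ∀ u v : K, θ (((v - u) * (1 - u * v))⁻¹) = ((θ v - θ u) * (1 - θ u * θ v))⁻¹ := by
    intro u v
    rw [map_inv₀]
    simp
  have hgen : schurPf (MvPolynomial.C ∘ x) (MvPolynomial.C ∘ a) (MvPolynomial.C ∘ b) Z C W D
      (fun i j => MvPolynomial.C (((x j - x i) * (1 - x i * x j))⁻¹)) =
      MvPolynomial.C (∏ i, ∏ j ∈ Finset.Ioi i, (x j - x i) * (1 - x i * x j))⁻¹ *
        schurProd (MvPolynomial.C ∘ x) (MvPolynomial.C ∘ a) (MvPolynomial.C ∘ b) Z C W D := by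
    apply hφ
    rw [map_mul, schurPf_map, schurProd_map]
    have h := schur_of_ne_zero hn (θ ∘ x) (θ ∘ a) (θ ∘ b) (z := φ ∘ Z) (c := φ ∘ C) (w := φ ∘ W)
      (d := φ ∘ D) ?_ (fun k => ?_) ?_ (fun k => ?_) fun i j hij => ?_
    · have h1 : ∀ i j, φ (MvPolynomial.C (((x j - x i) * (1 - x i * x j))⁻¹)) =
          (((θ ∘ x) j - (θ ∘ x) i) * (1 - (θ ∘ x) i * (θ ∘ x) j))⁻¹ := fun i j => hθ _ _
      have h2 : φ (MvPolynomial.C (∏ i, ∏ j ∈ Finset.Ioi i, (x j - x i) * (1 - x i * x j))⁻¹) =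
          (∏ i, ∏ j ∈ Finset.Ioi i, ((θ ∘ x) j - (θ ∘ x) i) * (1 - (θ ∘ x) i * (θ ∘ x) j))⁻¹ := by
        change θ _ = _
        rw [map_inv₀]
        simp
      simp only [h1, h2]
      exact h
    · rw [← F_map, map_ne_zero_iff φ hφ]
      refine F_X_ne_zero (ι₁ := fun k => Sum.inl (Sum.inl k)) (ι₂ := fun k => Sum.inl (Sum.inr k))
        ?_ ?_ ?_
      · exact Sum.inl_injective.comp Sum.inl_injective
      · exact Sum.inl_injective.comp Sum.inr_injective
      · simp
    · exact (map_ne_zero_iff φ hφ).mpr (MvPolynomial.X_ne_zero _)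
    · rw [← F_map, map_ne_zero_iff φ hφ]
      refine F_X_ne_zero (ι₁ := fun k => Sum.inr (Sum.inl k)) (ι₂ := fun k => Sum.inr (Sum.inr k))
        ?_ ?_ ?_
      · exact Sum.inr_injective.comp Sum.inl_injective
      · exact Sum.inr_injective.comp Sum.inr_injective
      · simp
    · exact (map_ne_zero_iff φ hφ).mpr (MvPolynomial.X_ne_zero _)
    · simpa using (map_ne_zero_iff θ θ.injective).mpr (hx i j hij)
  have h := congrArg ev hgen
  rw [map_mul, schurPf_map, schurProd_map] at h
  have hC : ∀ u : Fin (2 * n) → K, ev ∘ (MvPolynomial.C ∘ u) = u := fun u => funext fun k => MvPolynomial.eval_C _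
  have hC0 : ∀ u : K, ev (MvPolynomial.C u) = u := fun u => MvPolynomial.eval_C _
  have hZ : ev ∘ Z = z := funext fun k => (MvPolynomial.eval_X _).trans rfl
  have hC' : ev ∘ C = c := funext fun k => (MvPolynomial.eval_X _).trans rfl
  have hW : ev ∘ W = w := funext fun k => (MvPolynomial.eval_X _).trans rfl
  have hD : ev ∘ D = d := funext fun k => (MvPolynomial.eval_X _).trans rfl
  simp only [hC, hZ, hC', hW, hD, hC0] at h
  exact h

end CauchyVariation

/-! ### Both identities with their denominators restored -/

theorem mainTheorem1 {K : Type*} [Field K] :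
    -- (a)
    (∀ (n p q : ℕ), 0 < n → ∀ (x y a b : Fin n → K) (z c : Fin (p + q) → K),
      (∀ i j, (y j - x i) * (1 - x i * y j) ≠ 0) →
      (Matrix.of fun i j : Fin n =>
          F (p + 1) (q + 1)
              (Fin.append ![x i, y j] z ∘ Fin.cast (by omega))
              (Fin.append ![a i, b j] c ∘ Fin.cast (by omega)) /
            ((y j - x i) * (1 - x i * y j))).det =
        (-1) ^ (n * (n - 1) / 2) / (∏ i, ∏ j, (y j - x i) * (1 - x i * y j)) *
          F p q z c ^ (n - 1) *
          F (n + p) (n + q)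
            (Fin.append (Fin.append x y) z ∘ Fin.cast (by omega))
            (Fin.append (Fin.append a b) c ∘ Fin.cast (by omega))) ∧
    -- (b)
    (∀ (n p q r s : ℕ), 0 < n → ∀ (x a b : Fin (2 * n) → K)
      (z c : Fin (p + q) → K) (w d : Fin (r + s) → K),
      (∀ i j, i < j → (x j - x i) * (1 - x i * x j) ≠ 0) →
      pfaffian (Matrix.of fun i j : Fin (2 * n) =>
          F (p + 1) (q + 1)
              (Fin.append ![x i, x j] z ∘ Fin.cast (by omega))
              (Fin.append ![a i, a j] c ∘ Fin.cast (by omega)) *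
            F (r + 1) (s + 1)
              (Fin.append ![x i, x j] w ∘ Fin.cast (by omega))
              (Fin.append ![b i, b j] d ∘ Fin.cast (by omega)) /
            ((x j - x i) * (1 - x i * x j))) =
        1 / (∏ i, ∏ j ∈ Finset.Ioi i, (x j - x i) * (1 - x i * x j)) *
          F p q z c ^ (n - 1) * F r s w d ^ (n - 1) *
          F (n + p) (n + q)
            (Fin.append x z ∘ Fin.cast (by omega))
            (Fin.append a c ∘ Fin.cast (by omega)) *
          F (n + r) (n + s)
            (Fin.append x w ∘ Fin.cast (by omega))
            (Fin.append b d ∘ Fin.cast (by omega))) := by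
  constructor
  · intro n p q hn x y a b z c hd
    have h := cauchyDet_eq_cauchyProd hn x y a b z c
    have hr : ∀ i, ∏ k, (y k - x i) * (1 - x i * y k) ≠ 0 := fun i =>
      Finset.prod_ne_zero_iff.mpr fun k _ => hd i k
    -- The common denominator of row `i` is factored out; in column `j` the product over `k ≠ j` is
    -- left.
    have hM : (Matrix.of fun i j : Fin n =>
          F (p + 1) (q + 1)
              (Fin.append ![x i, y j] z ∘ Fin.cast (by omega))
              (Fin.append ![a i, b j] c ∘ Fin.cast (by omega)) /
            ((y j - x i) * (1 - x i * y j))) =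
        Matrix.of fun i j => (∏ k, (y k - x i) * (1 - x i * y k))⁻¹ *
          (Matrix.of fun i j => F₂ p q (x i) (y j) (a i) (b j) z c *
            ∏ k ∈ Finset.univ.erase j, ((y k - x i) * (1 - x i * y k))) i j := by
      ext i j
      have h1 := hr i
      rw [← Finset.mul_prod_erase Finset.univ _ (Finset.mem_univ j)] at h1
      simp only [Matrix.of_apply]
      rw [← Finset.mul_prod_erase Finset.univ (fun k => (y k - x i) * (1 - x i * y k))
        (Finset.mem_univ j), ← F₂, mul_inv, div_eq_mul_inv]
      have h2 := right_ne_zero_of_mul h1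
      field_simp
    rw [hM, Matrix.det_mul_column]
    change _ * cauchyDet x y a b z c = _
    rw [h, cauchyProd, Finset.prod_inv_distrib]
    ring
  · intro n p q r s hn x a b z c w d hx
    have h := schurPf_eq_schurProd hn x a b z c w d hx
    rw [schurPf, schurProd] at h
    simp only [← div_eq_mul_inv] at h
    refine h.trans ?_
    rw [one_div]
    ring
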